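/- \textbf{Proposition (Type II moment summations).} Write $(x)_n=x(x+1)\cdots(x+n-1)$, $(x)_0=1$, and $(x)_{-1}=1/(x-1)$. Let $a,b,c,d\in\mathbb R$ and $\delta:=c+d-a-b$ satisfy $$a,b,\delta>0,\qquad c,\;d,\;d-a,\;d-b,\;c+1-a,\;c-b\notin\{0,-1,-2,\dots\},\qquad c-d\notin\mathbb Z .$$ On $[0,1]$ let $$w_1(x)={}_2F_1\!\left[{c-b,\;d-b\atop \delta};1-x\right],\qquad w_2(x)=\frac cb\,{}_2F_1\!\left[{c-b,\;d-b-1\atop \delta};1-x\right],\qquad d\mu(x)=\frac{\Gamma(c)\Gamma(d)}{\Gamma(a)\Gamma(b)\Gamma(\delta)}x^{a-1}(1-x)^{\delta-1}\,dx .$$ Then $w_1$ and $w_2$ are integrable with respect to $d\mu$, and for every $N\in\mathbb N_0$ there is a unique monic polynomial $B^{(N)}$ of degree $N$ (the type II multiple orthogonal polynomial on the step-line) with $$\int_0^1B^{(N)}x^kw_1\,d\mu=0\ \ (0\le k<\lceil N/2\rceil),\qquad \int_0^1B^{(N)}x^kw_2\,d\mu=0\ \ (0\le k<\lfloor N/2\rfloor).$$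 For $n,m\in\mathbb N_0$, $j\in\{1,2\}$ define the generalized type II moments $$\eta^{(2n)}_{m,j}=\int_0^1B^{(2n)}(x)x^{n+m}w_j(x)\,d\mu(x),\qquad \eta^{(2n+1)}_{m,j}=\int_0^1B^{(2n+1)}(x)x^{n+m}w_j(x)\,d\mu(x).$$ \emph{Remainders.} For $z\in\mathbb C\setminus[0,1]$ let $\mathscr S_j(z)=\int_0^1\frac{w_j(x)}{z-x}d\mu(x)$, $f^{(N)}_j(z)=\int_0^1\frac{B^{(N)}(x)}{z-x}w_j(x)\,d\mu(x)$ and $P^{(N)}_j(z)=\int_0^1\frac{B^{(N)}(z)-B^{(N)}(x)}{z-x}w_j(x)\,d\mu(x)$. Then, for all $N\in\mathbb N_0$ and $j\in\{1,2\}$, $P^{(N)}_j$ is a polynomial with real coefficients of degree less than $N$ (zero if $N=0$), $B^{(N)}\mathscr S_j-P^{(N)}_j=f^{(N)}_j$ on $\mathbb C\setminus[0,1]$, and $$f^{(N)}_j(z)=\sum_{k=0}^\infty\frac{\eta^{(N)}_{k,j}}{z^{\lfloor N/2\rfloor+k+1}},$$ locally uniformly on $\{|z|>1\}$. Moreover $\eta^{(2n+1)}_{0,1}=0$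 for all $n\in\mathbb N_0$. \emph{Summations.} For all $n\in\mathbb N_0$ (in (1) and (3) with the exception of the case $n=0$, $d=1$, where the right-hand side is not defined): (1) For $m\ge1$ and $(\theta_1,\dots,\theta_{2m+1})=(c,c+1,\dots,c+m-1,\;d-1,d,\dots,d+m-1)$, $$\eta^{(2n)}_{m,1}=\frac{(2n)!\,(a)_{2n}(b)_{2n}}{(c)_{3n}(d)_{3n-1}}\sum_{l=1}^{2m+1}\frac{(\theta_l-a-m+1)_{n+m}\,(\theta_l-b-m+1)_{n+m}}{\bigl(\prod_{i\ne l}(\theta_i-\theta_l)\bigr)(\theta_l+n)\,(\theta_l+n+1)_{2n}} .$$ (2) For $m\ge1$ and $(\theta_1,\dots,\theta_{2m})=(c,c+1,\dots,c+m-1,\;d,d+1,\dots,d+m-1)$, $$\eta^{(2n+1)}_{m,1}=-\frac{(2n+1)!\,(a)_{2n+1}(b)_{2n+1}}{(c)_{3n+1}(d)_{3n+1}}\sum_{l=1}^{2m}\frac{(\theta_l-a-m+1)_{n+m}\,(\theta_l-b-m+1)_{n+m}}{\bigl(\prod_{i\ne l}(\theta_i-\theta_l)\bigr)(\theta_l+n)\,(\theta_l+n+1)_{2n+1}}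 .$$ (3) For $m\ge0$ and $(\theta_1,\dots,\theta_{2m+2})=(c,c+1,\dots,c+m,\;d-1,d,\dots,d+m-1)$, $$\eta^{(2n)}_{m,2}=-\frac cb\,\frac{(2n)!\,(a)_{2n}(b)_{2n}}{(c)_{3n}(d)_{3n-1}}\sum_{l=1}^{2m+2}\frac{(\theta_l-a-m+1)_{n+m}\,(\theta_l-b-m)_{n+m+1}}{\bigl(\prod_{i\ne l}(\theta_i-\theta_l)\bigr)(\theta_l+n)\,(\theta_l+n+1)_{2n}} .$$ (4) For $m\ge1$ and $(\theta_1,\dots,\theta_{2m+1})=(c,c+1,\dots,c+m,\;d,d+1,\dots,d+m-1)$, $$\eta^{(2n+1)}_{m,2}=\frac cb\,\frac{(2n+1)!\,(a)_{2n+1}(b)_{2n+1}}{(c)_{3n+1}(d)_{3n+1}}\sum_{l=1}^{2m+1}\frac{(\theta_l-a-m+1)_{n+m}\,(\theta_l-b-m)_{n+m+1}}{\bigl(\prod_{i\ne l}(\theta_i-\theta_l)\bigr)(\theta_l+n)\,(\theta_l+n+1)_{2n+1}} .$$ -/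

import Mathlib

open Polynomial

noncomputable section

namespace HypMOP

/-- The Pochhammer symbol `(x)_n = x (x+1) ⋯ (x+n-1)`. -/
def poch (x : ℝ) (n : ℕ) : ℝ := (ascPochhammer ℝ n).eval x

/-- The Pochhammer symbol with integer index: `(x)_{-k} = 1 / (x-k)_k` for `k ≥ 1`. -/
def pochInt (x : ℝ) : ℤ → ℝ
  | Int.ofNat n => poch x n
  | Int.negSucc n => 1 / poch (x - (n + 1)) (n + 1)

/-- The density of `dμ` with respect to Lebesgue measure on `(0, 1)`, with `δ = c + d - a - b`.
It can be negative (when `c < 0` or `d < 0`), so `dμ` is used through its density. -/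
def muDensity (a b c d x : ℝ) : ℝ :=
  Real.Gamma c * Real.Gamma d / (Real.Gamma a * Real.Gamma b * Real.Gamma (c + d - a - b))
    * x ^ (a - 1) * (1 - x) ^ (c + d - a - b - 1)

/-- The weights `w₁` (index `0`) and `w₂` (index `1`). -/
def weight (a b c d : ℝ) : Fin 2 → ℝ → ℝ :=
  ![fun x => ordinaryHypergeometric (c - b) (d - b) (c + d - a - b) (1 - x),
    fun x => c / b * ordinaryHypergeometric (c - b) (d - b - 1) (c + d - a - b) (1 - x)]

/-- `∫₀¹ f(x) w_j(x) dμ(x)` for real or complex valued `f`. -/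
def wInt {E : Type*} [NormedAddCommGroup E] [NormedSpace ℝ E]
    (a b c d : ℝ) (j : Fin 2) (f : ℝ → E) : E :=
  ∫ x in (0 : ℝ)..1, (weight a b c d j x * muDensity a b c d x) • f x

/-- `B` is a monic type II multiple orthogonal polynomial `B^(N)` of degree `N` on the step-line:
with `(ν₁, ν₂) = (n, n)` if `N = 2n` and `(ν₁, ν₂) = (n+1, n)` if `N = 2n+1`, it is orthogonal
with respect to `w_j dμ` to `x^k` for `k < ν_j`. -/
def IsTypeII (a b c d : ℝ) (N : ℕ) (B : ℝ[X]) : Prop :=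
  B.Monic ∧ B.natDegree = N ∧
    (∀ k < (N + 1) / 2, wInt a b c d 0 (fun x => B.eval x * x ^ k) = 0) ∧
    (∀ k < N / 2, wInt a b c d 1 (fun x => B.eval x * x ^ k) = 0)

/-- The generalized type II moment `∫₀¹ B(x) x^(n+m) w_j(x) dμ(x)`; it is `η_{m,j}^(2n)` for
`B = B^(2n)` and `η_{m,j}^(2n+1)` for `B = B^(2n+1)`. -/
def eta (a b c d : ℝ) (B : ℝ[X]) (j : Fin 2) (n m : ℕ) : ℝ :=
  wInt a b c d j (fun x => B.eval x * x ^ (n + m))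

/-- The segment `[0, 1]` in the complex plane. -/
def unitSegment : Set ℂ := (fun x : ℝ => (x : ℂ)) '' Set.Icc 0 1

/-- The Stieltjes-Markov transform of the weight `w_j`. -/
def stieltjes (a b c d : ℝ) (j : Fin 2) (z : ℂ) : ℂ :=
  wInt a b c d j (fun x => 1 / (z - (x : ℂ)))

/-- The function of the second kind `∫₀¹ B(x) / (z - x) w_j(x) dμ(x)`. -/
def secondKind (a b c d : ℝ) (B : ℝ[X]) (j : Fin 2) (z : ℂ) : ℂ :=
  wInt a b c d j (fun x => ((B.eval x : ℝ) : ℂ) / (z - (x : ℂ)))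

/-- The associated polynomial `∫₀¹ (B(z) - B(x)) / (z - x) w_j(x) dμ(x)` as a function of `z`. -/
def associated (a b c d : ℝ) (B : ℝ[X]) (j : Fin 2) (z : ℂ) : ℂ :=
  wInt a b c d j (fun x => (aeval z B - ((B.eval x : ℝ) : ℂ)) / (z - (x : ℂ)))

/-- The list `(c, c+1, …, c+p-1, e, e+1, …, e+q-1)`. -/
def theta (c e : ℝ) (p q : ℕ) : Fin (p + q) → ℝ :=
  Fin.append (fun i : Fin p => c + (i : ℕ)) (fun i : Fin q => e + (i : ℕ))

end HypMOP

end

namespace HypMOP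

/-! ### Pochhammer symbols and finite differences of rational functions. -/

section

open Finset

/-! Everything reduces to explicit moments. Expanding the hypergeometric weight in powers of `1 - x`
and integrating termwise against Beta kernels gives a `₂F₁` at `1`, which Gauss's theorem evaluates.
The k-th moment of `w₁ dμ` is `(a)_k (b)_k / ((c)_k (d)_k)`; that of `w₂ dμ` is `c / b` times the
same ratio with the indices at `b` and `c` raised by one (`weight_moment`, `wInt_poly_mul_pow`). The
rest of the orthogonality and summation theory is algebra with the functional `pairing`.

On the step-line the orthogonality conditions interleave: condition `i` has shifts `r = i / 2` and
`s = (i + 1) / 2`. For `i < N`, all moment ratios share one factor depending on `k`, and what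
remains is a polynomial in `k` of degree below `N` (`moment_eq_momentPoly`). The polynomial whose
k-th coefficient is a signed binomial divided by that factor turns each condition into an N-th
difference of such a polynomial, which vanishes. This is the `₃F₂` polynomial `typeII`. Uniqueness
is nonsingularity of the moment matrix: a relation between its rows is a combination of the
polynomials `momentPoly` vanishing at `0, …, N - 1`, hence identically, and these polynomials are
linearly independent.

For the higher moments `eta` the same cancellation leaves a rational function of `k` with simple
poles. Its N-th difference is a sum over those poles (`sum_choose_mul_div_prod`), which is the sum
over `theta` in the four formulas.

The remainders come from the geometric expansion of `1 / (z - x)` in powers of `x / z`;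
orthogonality removes the leading terms. -/

@[simp] lemma poch_zero (x : ℝ) : poch x 0 = 1 := by simp [poch]

lemma poch_succ (x : ℝ) (n : ℕ) : poch x (n + 1) = poch x n * (x + n) := by
  simp [poch, ascPochhammer_succ_eval]

lemma poch_eq_prod (x : ℝ) (n : ℕ) : poch x n = ∏ j ∈ range n, (x + j) := by
  induction n with
  | zero => simp
  | succ n ih => rw [poch_succ, ih, prod_range_succ]

lemma poch_add (x : ℝ) (m n : ℕ) : poch x (m + n) = poch x m * poch (x + m) n := by
  induction n with
  | zero => simp
  | succ n ih => rw [← add_assoc, poch_succ, poch_succ, ih]; push_cast; ring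

lemma poch_succ_left (x : ℝ) (n : ℕ) : poch x (n + 1) = x * poch (x + 1) n := by
  rw [add_comm, poch_add, show (1 : ℕ) = 0 + 1 from rfl, poch_succ]; simp

lemma poch_ne_zero {x : ℝ} (hx : ∀ k : ℕ, x ≠ -(k : ℝ)) (n : ℕ) : poch x n ≠ 0 := by
  rw [poch_eq_prod, prod_ne_zero_iff]
  intro j _ h
  exact hx j (by linarith)

lemma poch_pos {x : ℝ} (hx : 0 < x) (n : ℕ) : 0 < poch x n := ascPochhammer_pos n x hx

lemma add_nat_ne_neg_nat {x : ℝ} (hx : ∀ k : ℕ, x ≠ -(k : ℝ)) (m : ℕ) :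
    ∀ k : ℕ, x + m ≠ -(k : ℝ) := by
  intro k h
  exact hx (k + m) (by push_cast; linarith)

lemma ne_neg_nat_of_pos {x : ℝ} (hx : 0 < x) (k : ℕ) : x ≠ -(k : ℝ) := by
  have : (0 : ℝ) ≤ k := k.cast_nonneg
  linarith

/-- Reflection of the Pochhammer symbol. -/
lemma poch_sub_reflect (u x : ℝ) (n : ℕ) : poch (u - x) n = (-1) ^ n * poch (x - u - n + 1) n := by
  induction n with
  | zero => simp
  | succ n ih =>
    rw [poch_succ, ih, poch_succ_left]
    have : x - u - ((n + 1 : ℕ) : ℝ) + 1 + 1 = x - u - n + 1 := by push_cast; ring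
    rw [this]; push_cast; ring

lemma prod_neg_sub_eq_poch (x : ℝ) (n : ℕ) :
    ∏ j ∈ range n, (-x - (j : ℝ)) = (-1) ^ n * poch x n := by
  rw [poch_eq_prod, ← card_range n, ← prod_const, card_range, ← prod_mul_distrib]
  exact prod_congr rfl fun j _ => by ring

/-- These are the inverse Lagrange weights at the nodes `0, …, N`; up to `N!` and sign they produce
binomial coefficients. -/
lemma prod_range_erase_sub {k N : ℕ} (hk : k ≤ N) :
    ∏ j ∈ (range (N + 1)).erase k, ((k : ℝ) - j) = (-1) ^ (N + k) * (k.factorial * (N - k).factorial) := by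
  induction N, hk using Nat.le_induction with
  | base =>
    rw [range_add_one, erase_insert (by simp), ← prod_range_reflect, ← prod_range_add_one_eq_factorial]
    rw [← two_mul, pow_mul]
    simp only [neg_one_sq, one_pow, one_mul, Nat.sub_self, Nat.factorial_zero, Nat.cast_one, mul_one]
    push_cast
    refine prod_congr rfl fun j hj => ?_
    have := mem_range.1 hj
    rw [show k - 1 - j = k - (1 + j) by omega, Nat.cast_sub (by omega)]
    push_cast; ring
  | succ N hk ih =>
    rw [range_add_one, erase_insert_of_ne (by omega), prod_insert (by simp), ih,
      show N + 1 - k = (N - k) + 1 by omega, Nat.factorial_succ]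
    push_cast
    rw [Nat.cast_sub hk, show N + 1 + k = N + k + 1 by omega, pow_succ]
    ring

/-- The `N`-th difference at `0` of a rational function with simple poles, expressed through its
residues. -/
lemma sum_choose_mul_div_prod {ι : Type*} [Fintype ι] [DecidableEq ι] (N : ℕ) (x : ι → ℝ)
    (hx : Function.Injective x) (hxN : ∀ l, ∀ k : ℕ, x l ≠ -(k : ℝ)) (P : ℝ[X])
    (hP : P.degree < ((N + Fintype.card ι : ℕ) : WithBot ℕ)) :
    ∑ k ∈ range (N + 1), (-1) ^ k * (N.choose k : ℝ) * P.eval (k : ℝ) / ∏ l, (x l + k) =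
      N.factorial * ∑ l, P.eval (-x l) / ((∏ i ∈ univ.erase l, (x i - x l)) * poch (x l) (N + 1)) := by
  classical
  let s : Finset (ℕ ⊕ ι) := (range (N + 1)).disjSum univ
  let v : ℕ ⊕ ι → ℝ := Sum.elim (fun k => (k : ℝ)) (fun l => -x l)
  have hv : Set.InjOn v s := by
    rintro (i | i) - (j | j) - h
    · simpa [v] using h
    · simp only [v, Sum.elim_inl, Sum.elim_inr] at h
      exact absurd (by linarith) (hxN j i)
    · simp only [v, Sum.elim_inl, Sum.elim_inr] at h
      exact absurd (by linarith) (hxN i j)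
    · simp only [v, Sum.elim_inr, neg_inj] at h
      rw [hx h]
  have hs : s.card = N + Fintype.card ι + 1 := by
    simp only [s, card_disjSum, card_range, card_univ]; ring
  -- Interpolate `P` at `0, …, N` together with the poles `-x l`. The degree bound makes the top
  -- coefficient vanish, so the residues of `P / (∏ (X - k) ∏ (X + x l))` sum to zero; the two kinds
  -- of nodes give the two sides.
  have key := Lagrange.coeff_eq_sum hv (P := P) (hP.trans (by rw [hs]; exact_mod_cast Nat.lt_succ_self _))
  rw [hs, Nat.add_sub_cancel, coeff_eq_zero_of_degree_lt hP, sum_disjSum] at key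
  have e1 : ∀ k, s.erase (Sum.inl k) = ((range (N + 1)).erase k).disjSum univ := by
    intro k; ext (j | j) <;> simp [s]
  have e2 : ∀ l, s.erase (Sum.inr l) = (range (N + 1)).disjSum (univ.erase l) := by
    intro k; ext (j | j) <;> simp [s]
  simp only [e1, e2, prod_disjSum] at key
  simp only [v, Sum.elim_inl, Sum.elim_inr] at key
  have h1 : ∀ k ∈ range (N + 1), eval (k : ℝ) P /
      ((∏ j ∈ (range (N + 1)).erase k, ((k : ℝ) - j)) * ∏ l, ((k : ℝ) - -x l)) =
      ((-1) ^ N / N.factorial) *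
        ((-1) ^ k * (N.choose k : ℝ) * P.eval (k : ℝ) / ∏ l, (x l + k)) := by
    intro k hk
    have hk : k ≤ N := by simpa [Nat.lt_succ_iff] using hk
    rw [prod_range_erase_sub hk, Nat.cast_choose ℝ hk]
    have : ∏ l, ((k : ℝ) - -x l) = ∏ l, (x l + k) := prod_congr rfl fun l _ => by ring
    rw [this]
    have hprod : ∏ l, (x l + k) ≠ 0 := by
      rw [prod_ne_zero_iff]; intro l _ h; exact hxN l k (by linarith)
    have := Nat.factorial_ne_zero
    have hN : (N.factorial : ℝ) ≠ 0 := by exact_mod_cast this _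
    have hk' : (k.factorial : ℝ) ≠ 0 := by exact_mod_cast this _
    have hNk : ((N - k).factorial : ℝ) ≠ 0 := by exact_mod_cast this _
    have hsq : ((-1 : ℝ) ^ N * (-1) ^ k) * ((-1 : ℝ) ^ N * (-1) ^ k) = 1 := by
      rw [← pow_add, ← mul_pow]; simp
    have hsgn : ((-1 : ℝ) ^ N * (-1) ^ k) ≠ 0 := by positivity
    rw [pow_add]
    field_simp
    linear_combination (-(eval (k : ℝ) P)) * hsq
  have h2 : ∀ l, eval (-x l) P /
      ((∏ j ∈ range (N + 1), (-x l - (j : ℝ))) * ∏ i ∈ univ.erase l, (-x l - -x i)) =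
      (-(-1) ^ N) * (P.eval (-x l) / ((∏ i ∈ univ.erase l, (x i - x l)) * poch (x l) (N + 1))) := by
    intro l
    rw [prod_neg_sub_eq_poch]
    have : ∏ i ∈ univ.erase l, (-x l - -x i) = ∏ i ∈ univ.erase l, (x i - x l) :=
      prod_congr rfl fun l _ => by ring
    rw [this, pow_succ]
    have hp : poch (x l) (N + 1) ≠ 0 := poch_ne_zero (hxN l) _
    have hprod : ∏ i ∈ univ.erase l, (x i - x l) ≠ 0 := by
      rw [prod_ne_zero_iff]
      intro i hi h
      exact (ne_of_mem_erase hi) (hx (by linarith))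
    have hsq : ((-1 : ℝ) ^ N) * ((-1 : ℝ) ^ N) = 1 := by rw [← mul_pow]; simp
    have hsgn : ((-1 : ℝ) ^ N) ≠ 0 := by positivity
    field_simp
    linear_combination (eval (-x l) P) * hsq
  rw [sum_congr rfl h1, sum_congr rfl fun l _ => h2 l, ← mul_sum, ← mul_sum] at key
  have hN : (N.factorial : ℝ) ≠ 0 := by exact_mod_cast N.factorial_ne_zero
  have hsgn : ((-1 : ℝ) ^ N) ≠ 0 := by positivity
  field_simp at key
  have := (mul_eq_zero.1 (key.symm.trans (zero_mul _))).resolve_left hsgn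
  linarith

lemma sum_choose_mul_eval_eq_zero (N : ℕ) (P : ℝ[X]) (hP : P.degree < (N : WithBot ℕ)) :
    ∑ k ∈ range (N + 1), (-1) ^ k * (N.choose k : ℝ) * P.eval (k : ℝ) = 0 := by
  have := sum_choose_mul_div_prod N (fun i : Fin 0 => (0 : ℝ)) (fun i => i.elim0)
    (fun i => i.elim0) P (by simpa using hP)
  simpa using this

end

/-! ### Algebra of the moment functional: normality, the explicit polynomial, generalized moments.
-/

section

open Finset

/-- The polynomial `(a + X)_n`. -/
noncomputable def pochPoly (a : ℝ) (n : ℕ) : ℝ[X] := (ascPochhammer ℝ n).comp (X + C a)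

lemma pochPoly_eval (a t : ℝ) (n : ℕ) : (pochPoly a n).eval t = poch (a + t) n := by
  simp [pochPoly, poch, add_comm]

lemma pochPoly_natDegree_le (a : ℝ) (n : ℕ) : (pochPoly a n).natDegree ≤ n := by
  rw [pochPoly, natDegree_comp]; simp [ascPochhammer_natDegree]

lemma pochPoly_succ_left (a : ℝ) (n : ℕ) :
    pochPoly a (n + 1) = (X + C a) * pochPoly (a + 1) n := by
  refine Polynomial.funext fun t => ?_
  simp only [pochPoly_eval, eval_mul, eval_add, eval_X, eval_C, poch_succ_left]
  rw [show a + 1 + t = a + t + 1 by ring, add_comm t a]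

@[simp] lemma pochPoly_zero (a : ℝ) : pochPoly a 0 = 1 := by simp [pochPoly]

/-- The polynomials that interpolate the ratios of moments. -/
noncomputable def momentPoly (a b c d : ℝ) (N i : ℕ) : ℝ[X] :=
  pochPoly a (i / 2) * pochPoly b ((i + 1) / 2) *
    pochPoly (c + ((i + 1) / 2 : ℕ)) (N / 2 - (i + 1) / 2) *
    pochPoly (d + (i / 2 : ℕ)) ((N - 1) / 2 - i / 2)

lemma momentPoly_degree_lt (a b c d : ℝ) {N i : ℕ} (hi : i < N) :
    (momentPoly a b c d N i).degree < (N : WithBot ℕ) := by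
  have : (momentPoly a b c d N i).natDegree ≤
      i / 2 + (i + 1) / 2 + (N / 2 - (i + 1) / 2) + ((N - 1) / 2 - i / 2) := by
    unfold momentPoly
    refine natDegree_mul_le_of_le (natDegree_mul_le_of_le (natDegree_mul_le_of_le ?_ ?_) ?_) ?_ <;>
      exact pochPoly_natDegree_le _ _
  have h2 : (momentPoly a b c d N i).natDegree < N := by omega
  exact degree_le_natDegree.trans_lt (by exact_mod_cast h2)

/-- Advancing one step on the step-line exchanges the roles of the two indices, so after removing
the factor `X + b` the family reappears with parameters `(b + 1, a, d, c + 1)`. -/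
lemma momentPoly_succ (a b c d : ℝ) (N i : ℕ) :
    momentPoly a b c d (N + 1) (i + 1) = (X + C b) * momentPoly (b + 1) a d (c + 1) N i := by
  unfold momentPoly
  rw [show (i + 1 + 1) / 2 = i / 2 + 1 by omega, show N + 1 - 1 = N by omega,
    show (N + 1) / 2 - (i / 2 + 1) = (N - 1) / 2 - i / 2 by omega, pochPoly_succ_left,
    show c + ((i / 2 + 1 : ℕ) : ℝ) = c + 1 + (i / 2 : ℕ) by push_cast; ring]
  ring

lemma momentPoly_zero_eval_ne_zero {a b c d : ℝ} (hdb : ∀ k : ℕ, d - b ≠ -(k : ℝ))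
    (hcb : ∀ k : ℕ, c - b ≠ -(k : ℝ)) (N : ℕ) : (momentPoly a b c d N 0).eval (-b) ≠ 0 := by
  unfold momentPoly
  simp only [eval_mul, pochPoly_eval]
  have h1 := poch_ne_zero hcb (N / 2)
  have h2 := poch_ne_zero hdb ((N - 1) / 2)
  rw [sub_eq_add_neg] at h1 h2
  simpa using ⟨h1, h2⟩

/-- Evaluation at `-b` kills every member except the one of index `0`. Dividing the rest by `X + b`
gives the family for `(b + 1, a, d, c + 1)`, and this substitution permutes the four nonvanishing
hypotheses, so the induction closes. -/
lemma momentPoly_linearIndependent (N : ℕ) : ∀ (a b c d : ℝ)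
    (_ : ∀ k : ℕ, d - a ≠ -(k : ℝ)) (_ : ∀ k : ℕ, d - b ≠ -(k : ℝ))
    (_ : ∀ k : ℕ, c + 1 - a ≠ -(k : ℝ)) (_ : ∀ k : ℕ, c - b ≠ -(k : ℝ)) (v : ℕ → ℝ),
    ∑ i ∈ range N, C (v i) * momentPoly a b c d N i = 0 → ∀ i < N, v i = 0 := by
  induction N with
  | zero => intro a b c d _ _ _ _ v _ i hi; omega
  | succ N ih =>
    intro a b c d hda hdb hca hcb v hv
    rw [sum_range_succ'] at hv
    have hsum : ∑ i ∈ range N, C (v (i + 1)) * momentPoly a b c d (N + 1) (i + 1) =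
        (X + C b) * ∑ i ∈ range N, C (v (i + 1)) * momentPoly (b + 1) a d (c + 1) N i := by
      rw [mul_sum]
      exact sum_congr rfl fun i _ => by rw [momentPoly_succ]; ring
    rw [hsum] at hv
    have h0 : v 0 = 0 := by
      have := congrArg (eval (-b)) hv
      simp only [eval_add, eval_mul, eval_X, eval_C, neg_add_cancel, zero_mul, zero_add,
        eval_zero] at this
      exact (mul_eq_zero.1 this).resolve_right (momentPoly_zero_eval_ne_zero hdb hcb _)
    rw [h0, C_0, zero_mul, add_zero] at hv
    have h1 := (mul_eq_zero.1 hv).resolve_left (X_add_C_ne_zero b)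
    have := ih (b + 1) a d (c + 1)
      (fun k h => hcb k (by linarith)) (fun k h => hca k (by linarith))
      (fun k h => hdb k (by linarith)) hda (fun i => v (i + 1)) h1
    intro i hi
    rcases i with _ | i
    · exact h0
    · exact this i (by omega)

/-- `(a)_{k+r} (b)_{k+s} / ((c)_{k+s} (d)_{k+r})`, the moments of the weights up to a factor. -/
noncomputable def moment (a b c d : ℝ) (r s k : ℕ) : ℝ :=
  poch a (k + r) * poch b (k + s) / (poch c (k + s) * poch d (k + r))

lemma moment_eq_momentPoly {a b c d : ℝ} (hc : ∀ k : ℕ, c ≠ -(k : ℝ)) (hd : ∀ k : ℕ, d ≠ -(k : ℝ))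
    {N i : ℕ} (hi : i < N) (k : ℕ) :
    moment a b c d (i / 2) ((i + 1) / 2) k =
      poch a k * poch b k / (poch c (N / 2 + k) * poch d ((N - 1) / 2 + k)) *
        (momentPoly a b c d N i).eval (k : ℝ) := by
  unfold moment momentPoly
  simp only [eval_mul, pochPoly_eval]
  have h1 : poch c (N / 2 + k) = poch c (k + (i + 1) / 2) *
      poch (c + ((i + 1) / 2 : ℕ) + k) (N / 2 - (i + 1) / 2) := by
    rw [show N / 2 + k = k + (i + 1) / 2 + (N / 2 - (i + 1) / 2) by omega, poch_add]
    push_cast; congr 2; ring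
  have h2 : poch d ((N - 1) / 2 + k) = poch d (k + i / 2) *
      poch (d + (i / 2 : ℕ) + k) ((N - 1) / 2 - i / 2) := by
    rw [show (N - 1) / 2 + k = k + i / 2 + ((N - 1) / 2 - i / 2) by omega, poch_add]
    push_cast; congr 2; ring
  have e1 := poch_ne_zero hc (N / 2 + k)
  have e2 := poch_ne_zero hd ((N - 1) / 2 + k)
  rw [h1] at e1 ⊢
  rw [h2] at e2 ⊢
  rw [poch_add a k, poch_add b k]
  have := left_ne_zero_of_mul e1
  have := right_ne_zero_of_mul e1
  have := left_ne_zero_of_mul e2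
  have := right_ne_zero_of_mul e2
  field_simp

/-- The functional with moments `moment a b c d r s`. -/
noncomputable def pairing (a b c d : ℝ) (r s : ℕ) (B : ℝ[X]) : ℝ :=
  B.sum fun k x => x * moment a b c d r s k

lemma pairing_eq_sum_range (a b c d : ℝ) (r s : ℕ) {B : ℝ[X]} {n : ℕ} (hn : B.natDegree < n) :
    pairing a b c d r s B = ∑ k ∈ range n, B.coeff k * moment a b c d r s k :=
  B.sum_over_range' (fun k => by simp) n hn

lemma pairing_sub (a b c d : ℝ) (r s : ℕ) (P Q : ℝ[X]) :
    pairing a b c d r s (P - Q) = pairing a b c d r s P - pairing a b c d r s Q := by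
  set n := max P.natDegree Q.natDegree + 1
  rw [pairing_eq_sum_range (n := n) (hn := (natDegree_sub_le P Q).trans_lt (by omega)),
    pairing_eq_sum_range (B := P) (n := n) (hn := by omega),
    pairing_eq_sum_range (B := Q) (n := n) (hn := by omega), ← sum_sub_distrib]
  exact sum_congr rfl fun k _ => by rw [coeff_sub]; ring

/-- Normality of the multi-indices on the step-line. -/
lemma eq_zero_of_pairing_eq_zero {a b c d : ℝ} (ha : 0 < a) (hb : 0 < b)
    (hc : ∀ k : ℕ, c ≠ -(k : ℝ)) (hd : ∀ k : ℕ, d ≠ -(k : ℝ))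
    (hda : ∀ k : ℕ, d - a ≠ -(k : ℝ)) (hdb : ∀ k : ℕ, d - b ≠ -(k : ℝ))
    (hca : ∀ k : ℕ, c + 1 - a ≠ -(k : ℝ)) (hcb : ∀ k : ℕ, c - b ≠ -(k : ℝ))
    {N : ℕ} {Q : ℝ[X]} (hQ : Q.degree < (N : WithBot ℕ))
    (h : ∀ i < N, pairing a b c d (i / 2) ((i + 1) / 2) Q = 0) : Q = 0 := by
  rcases Nat.eq_zero_or_pos N with rfl | hN
  · exact degree_eq_bot.1 (by simpa [Nat.WithBot.lt_zero_iff] using hQ)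
  let M : Matrix (Fin N) (Fin N) ℝ :=
    fun i k => moment a b c d ((i : ℕ) / 2) (((i : ℕ) + 1) / 2) (k : ℕ)
  by_contra hne
  have hQn : Q.natDegree < N := (natDegree_lt_iff_degree_lt hne).2 hQ
  have hq : (fun k : Fin N => Q.coeff k) ≠ 0 := by
    intro h0
    refine hne (leadingCoeff_eq_zero.1 ?_)
    exact congrFun h0 ⟨Q.natDegree, hQn⟩
  have hM : M.mulVec (fun k : Fin N => Q.coeff k) = 0 := by
    ext i
    have := h i i.2
    rw [pairing_eq_sum_range _ _ _ _ _ _ hQn,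
      ← Fin.sum_univ_eq_sum_range (fun k => Q.coeff k * moment a b c d _ _ k)] at this
    rw [Pi.zero_apply, ← this, Matrix.mulVec, dotProduct]
    exact sum_congr rfl fun k _ => mul_comm _ _
  -- A kernel vector on the right makes the square matrix singular, hence gives a relation between
  -- its rows. Read as a function of the column index, this relation is a polynomial of degree below
  -- `N` vanishing at `0, …, N - 1`.
  have hdet := Matrix.exists_mulVec_eq_zero_iff.1 ⟨_, hq, hM⟩
  obtain ⟨v, hv, hvM⟩ := Matrix.exists_vecMul_eq_zero_iff.2 hdet
  let w : ℕ → ℝ := fun i => if hi : i < N then v ⟨i, hi⟩ else 0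
  have hw : ∀ i : Fin N, w i = v i := fun i => by simp [w]
  have hpoly : ∑ i ∈ range N, C (w i) * momentPoly a b c d N i = 0 := by
    refine Polynomial.eq_zero_of_degree_lt_of_eval_index_eq_zero (s := range N)
      (v := fun k : ℕ => (k : ℝ)) (Nat.cast_injective.injOn) ?_ ?_
    · refine (degree_sum_le _ _).trans_lt ?_
      rw [Finset.sup_lt_iff (by simp)]
      intro i hi
      rw [card_range]
      refine lt_of_le_of_lt ?_ (momentPoly_degree_lt a b c d (mem_range.1 hi))
      rw [← smul_eq_C_mul]; exact degree_smul_le _ _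
    · intro k hk
      have := congrFun hvM ⟨k, mem_range.1 hk⟩
      simp only [Matrix.vecMul, dotProduct, Pi.zero_apply, M] at this
      rw [Finset.sum_congr rfl fun (i : Fin N) _ => by rw [moment_eq_momentPoly hc hd i.2, ← hw i],
        Fin.sum_univ_eq_sum_range (fun i => w i * (poch a k * poch b k /
          (poch c (N / 2 + k) * poch d ((N - 1) / 2 + k)) *
            (momentPoly a b c d N i).eval (k : ℝ))) N] at this
      have hK : poch a k * poch b k / (poch c (N / 2 + k) * poch d ((N - 1) / 2 + k)) ≠ 0 :=
        div_ne_zero (mul_ne_zero (poch_pos ha k).ne' (poch_pos hb k).ne')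
          (mul_ne_zero (poch_ne_zero hc _) (poch_ne_zero hd _))
      rw [eval_finsetSum]
      refine (mul_eq_zero.1 (Eq.trans ?_ this)).resolve_left hK
      rw [mul_sum]
      exact sum_congr rfl fun i _ => by rw [eval_mul, eval_C]; ring
  have := momentPoly_linearIndependent N a b c d hda hdb hca hcb w hpoly
  exact hv (funext fun i => by rw [← hw i, this i i.2]; rfl)

/-- The monic multiple of `₃F₂(-N, e, f; a, b; X)`. -/
noncomputable def hypPoly (a b e f : ℝ) (N : ℕ) : ℝ[X] :=
  ∑ k ∈ range (N + 1), C ((-1) ^ (N + k) * (N.choose k : ℝ) *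
    (poch a N * poch b N / (poch e N * poch f N)) *
      (poch e k * poch f k / (poch a k * poch b k))) * X ^ k

lemma hypPoly_coeff (a b e f : ℝ) {N k : ℕ} (hk : k ≤ N) :
    (hypPoly a b e f N).coeff k = (-1) ^ (N + k) * (N.choose k : ℝ) *
    (poch a N * poch b N / (poch e N * poch f N)) *
      (poch e k * poch f k / (poch a k * poch b k)) := by
  simp only [hypPoly, finsetSum_coeff, coeff_C_mul_X_pow]
  rw [sum_ite_eq, if_pos (mem_range.2 (Nat.lt_succ_of_le hk))]

lemma hypPoly_natDegree_le (a b e f : ℝ) (N : ℕ) : (hypPoly a b e f N).natDegree ≤ N :=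
  natDegree_sum_le_of_forall_le _ _ fun _ hk =>
    (natDegree_C_mul_X_pow_le _ _).trans (Nat.lt_succ_iff.1 (mem_range.1 hk))

lemma hypPoly_monic_natDegree {a b e f : ℝ} {N : ℕ} (ha : 0 < a) (hb : 0 < b)
    (he : poch e N ≠ 0) (hf : poch f N ≠ 0) :
    (hypPoly a b e f N).Monic ∧ (hypPoly a b e f N).natDegree = N := by
  have h1 : (hypPoly a b e f N).coeff N = 1 := by
    rw [hypPoly_coeff _ _ _ _ le_rfl, ← two_mul, pow_mul]
    have := (poch_pos ha N).ne'
    have := (poch_pos hb N).ne'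
    simp
    field_simp
  refine ⟨monic_of_natDegree_le_of_coeff_eq_one N (hypPoly_natDegree_le _ _ _ _ _) h1, ?_⟩
  exact natDegree_eq_of_le_of_coeff_ne_zero (hypPoly_natDegree_le _ _ _ _ _) (by simp [h1])

/-- The type II polynomial on the step-line. -/
noncomputable def typeII (a b c d : ℝ) (N : ℕ) : ℝ[X] :=
  hypPoly a b (c + (N / 2 : ℕ)) (d + ((N + 1) / 2 : ℕ) - 1) N

lemma typeII_param_ne {d : ℝ} (hd : ∀ k : ℕ, d ≠ -(k : ℝ)) (N : ℕ) :
    poch (d + ((N + 1) / 2 : ℕ) - 1) N ≠ 0 := by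
  rcases N with _ | N
  · simp
  · refine poch_ne_zero (fun k h => hd (k + N / 2) ?_) _
    rw [show (N + 1 + 1) / 2 = N / 2 + 1 by omega] at h
    push_cast at h ⊢
    linarith

lemma typeII_monic_natDegree {a b c d : ℝ} (ha : 0 < a) (hb : 0 < b)
    (hc : ∀ k : ℕ, c ≠ -(k : ℝ)) (hd : ∀ k : ℕ, d ≠ -(k : ℝ)) (N : ℕ) :
    (typeII a b c d N).Monic ∧ (typeII a b c d N).natDegree = N :=
  hypPoly_monic_natDegree ha hb (poch_ne_zero (add_nat_ne_neg_nat hc _) _) (typeII_param_ne hd N)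

/-- The upper parameters are chosen so that `(e)_k (f)_k / ((a)_k (b)_k)` cancels the common factor
of the moments up to a constant, leaving the N-th difference of `momentPoly`. -/
lemma pairing_typeII_eq_zero {a b c d : ℝ} (ha : 0 < a) (hb : 0 < b)
    (hc : ∀ k : ℕ, c ≠ -(k : ℝ)) (hd : ∀ k : ℕ, d ≠ -(k : ℝ)) {N i : ℕ} (hi : i < N) :
    pairing a b c d (i / 2) ((i + 1) / 2) (typeII a b c d N) = 0 := by
  rw [typeII, pairing_eq_sum_range _ _ _ _ _ _ (Nat.lt_succ_of_le (hypPoly_natDegree_le _ _ _ _ _))]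
  have hz := sum_choose_mul_eval_eq_zero N _ (momentPoly_degree_lt a b c d hi)
  set e := c + (N / 2 : ℕ) with he
  set f := d + ((N + 1) / 2 : ℕ) - 1 with hf
  have hf' : f = d + ((N - 1) / 2 : ℕ) := by
    rw [hf, show (N + 1) / 2 = (N - 1) / 2 + 1 by omega]; push_cast; ring
  have := congrArg (fun y => (-1) ^ N * (poch a N * poch b N / (poch e N * poch f N)) *
    (1 / (poch c (N / 2) * poch d ((N - 1) / 2))) * y) hz
  simp only [mul_zero] at this
  rw [← this, mul_sum]
  refine sum_congr rfl fun k hk => ?_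
  rw [hypPoly_coeff _ _ _ _ (Nat.lt_succ_iff.1 (mem_range.1 hk)),
    moment_eq_momentPoly hc hd hi, poch_add c, poch_add d, ← he, ← hf', pow_add]
  have h1 := (poch_pos ha k).ne'
  have h2 := (poch_pos hb k).ne'
  have h3 : poch e k ≠ 0 := poch_ne_zero (add_nat_ne_neg_nat hc _) _
  have h4 : poch f k ≠ 0 := by rw [hf']; exact poch_ne_zero (add_nat_ne_neg_nat hd _) _
  have h5 : poch c (N / 2) ≠ 0 := poch_ne_zero hc _
  have h6 : poch d ((N - 1) / 2) ≠ 0 := poch_ne_zero hd _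
  field_simp

/-- Generalized moments of `hypPoly` as sums over the poles of the ratio of moments. -/
lemma pairing_hypPoly {a b c d e f : ℝ} (ha : 0 < a) (hb : 0 < b)
    (hc : ∀ k : ℕ, c ≠ -(k : ℝ)) (hd : ∀ k : ℕ, d ≠ -(k : ℝ)) {N r s S R : ℕ}
    {Kc Kd : ℝ} (hKc : ∀ k, poch c (k + s) = Kc * (poch e k * poch (e + k) S))
    (hKd : ∀ k, poch d (k + r) = Kd * (poch f k * poch (f + k) R))
    (hrs : r + s < N + (S + R)) (x : Fin (S + R) → ℝ) (hx : Function.Injective x)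
    (hxN : ∀ l, ∀ k : ℕ, x l ≠ -(k : ℝ))
    (hxe : ∀ k : ℕ, ∏ l, (x l + k) = poch (e + k) S * poch (f + k) R) :
    pairing a b c d r s (hypPoly a b e f N) =
      (-1) ^ (N + r + s) * (N.factorial * poch a N * poch b N /
        ((Kc * poch e N) * (Kd * poch f N))) *
      ∑ l, poch (x l - a - r + 1) r * poch (x l - b - s + 1) s /
        ((∏ i ∈ univ.erase l, (x i - x l)) * poch (x l) (N + 1)) := by
  rw [pairing_eq_sum_range _ _ _ _ _ _ (Nat.lt_succ_of_le (hypPoly_natDegree_le _ _ _ _ _))]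
  have hP : (pochPoly a r * pochPoly b s).degree <
      ((N + Fintype.card (Fin (S + R)) : ℕ) : WithBot ℕ) := by
    rw [Fintype.card_fin]
    refine degree_le_natDegree.trans_lt ?_
    have := natDegree_mul_le_of_le (pochPoly_natDegree_le a r) (pochPoly_natDegree_le b s)
    exact_mod_cast this.trans_lt hrs
  have key := sum_choose_mul_div_prod N x hx hxN _ hP
  simp only [eval_mul, pochPoly_eval] at key
  have h1 : ∀ k ∈ range (N + 1), (hypPoly a b e f N).coeff k * moment a b c d r s k =
      ((-1) ^ N * (poch a N * poch b N / ((Kc * poch e N) * (Kd * poch f N)))) *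
        ((-1) ^ k * (N.choose k : ℝ) * (poch (a + k) r * poch (b + k) s) / ∏ l, (x l + k)) := by
    intro k hk
    have e1 := poch_ne_zero hc (k + s)
    have e2 := poch_ne_zero hd (k + r)
    rw [hypPoly_coeff _ _ _ _ (Nat.lt_succ_iff.1 (mem_range.1 hk)), moment, hxe]
    rw [hKc] at e1 ⊢
    rw [hKd] at e2 ⊢
    rw [poch_add a k, poch_add b k, pow_add]
    have h1 := (poch_pos ha k).ne'
    have h2 := (poch_pos hb k).ne'
    have := left_ne_zero_of_mul e1
    have := left_ne_zero_of_mul (right_ne_zero_of_mul e1)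
    have := right_ne_zero_of_mul (right_ne_zero_of_mul e1)
    have := left_ne_zero_of_mul e2
    have := left_ne_zero_of_mul (right_ne_zero_of_mul e2)
    have := right_ne_zero_of_mul (right_ne_zero_of_mul e2)
    generalize poch a N * poch b N = A
    generalize poch e N = E1
    generalize poch f N = F1
    generalize poch e k = E at *
    generalize poch f k = F at *
    generalize poch a k = A1 at *
    generalize poch b k = B1 at *
    generalize poch (e + k) S = E2 at *
    generalize poch (f + k) R = F2 at *
    generalize poch (a + k) r = A3
    generalize poch (b + k) s = B3
    -- The factors `(e)_N` and `(f)_N` occur as the same inverses on both sides; kept opaque, they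
    -- need no nonvanishing argument.
    have hl : ∀ u v : ℝ, u * (A / (E1 * F1)) * v = u * A * (E1⁻¹ * F1⁻¹) * v := by
      intro u v; rw [div_eq_mul_inv, mul_inv]; ring
    have hr : A / (Kc * E1 * (Kd * F1)) = A * (Kc⁻¹ * E1⁻¹ * (Kd⁻¹ * F1⁻¹)) := by
      rw [div_eq_mul_inv, mul_inv, mul_inv, mul_inv]
    rw [hl, hr]
    generalize E1⁻¹ = E1'
    generalize F1⁻¹ = F1'
    field_simp
  rw [sum_congr rfl h1, ← mul_sum, key]
  -- The residues are evaluated at `-x l`; reflecting the two Pochhammer symbols produces the sign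
  -- `(-1) ^ (r + s)`.
  have h2 : ∀ l, poch (a + -x l) r * poch (b + -x l) s /
        ((∏ i ∈ univ.erase l, (x i - x l)) * poch (x l) (N + 1)) =
      (-1) ^ (r + s) * (poch (x l - a - r + 1) r * poch (x l - b - s + 1) s /
        ((∏ i ∈ univ.erase l, (x i - x l)) * poch (x l) (N + 1))) := by
    intro l
    rw [← sub_eq_add_neg, ← sub_eq_add_neg, poch_sub_reflect, poch_sub_reflect b, pow_add]
    ring
  rw [sum_congr rfl fun l _ => h2 l, ← mul_sum, add_assoc N, pow_add _ N]
  ring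

end

/-! ### Gauss's summation theorem. -/

section

open Finset Filter Topology

/-- The coefficients of `₂F₁(α, β; γ; x)`. -/
noncomputable def hypCoeff (α β γ : ℝ) (n : ℕ) : ℝ :=
  poch α n * poch β n / (poch γ n * n.factorial)

lemma hypCoeff_succ {α β γ : ℝ} (hγ : 0 < γ) (n : ℕ) :
    hypCoeff α β γ (n + 1) * ((γ + n) * (n + 1)) = hypCoeff α β γ n * ((α + n) * (β + n)) := by
  have h1 := (poch_pos hγ n).ne'
  have h2 : γ + n ≠ 0 := by positivity
  have h3 : (n.factorial : ℝ) ≠ 0 := by exact_mod_cast n.factorial_ne_zero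
  unfold hypCoeff
  rw [poch_succ, poch_succ, poch_succ, Nat.factorial_succ]
  push_cast
  field_simp

/-- Euler's limit, inverted. It also holds at the poles of Gamma: the Pochhammer symbol is
eventually zero there, and `Real.Gamma` takes the value `0`, whose inverse is `0`. So no condition
on `x` is needed. -/
lemma tendsto_poch_div (x : ℝ) : Tendsto
    (fun n : ℕ => poch x (n + 1) / ((n : ℝ) ^ x * n.factorial)) atTop (𝓝 (Real.Gamma x)⁻¹) := by
  by_cases hx : ∀ k : ℕ, x ≠ -(k : ℝ)
  · refine ((Real.GammaSeq_tendsto_Gamma x).inv₀ (Real.Gamma_ne_zero hx)).congr fun n => ?_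
    rw [Real.GammaSeq, inv_div, poch_eq_prod]
  · push Not at hx
    obtain ⟨k, rfl⟩ := hx
    rw [Real.Gamma_neg_nat_eq_zero, inv_zero]
    refine tendsto_const_nhds.congr' ?_
    filter_upwards [eventually_ge_atTop k] with n hn
    rw [poch_eq_prod, prod_eq_zero (i := k) (by simp; omega) (by ring), zero_div]

lemma hypCoeff_isBigO (α β : ℝ) {γ : ℝ} (hγ : 0 < γ) :
    (fun n : ℕ => hypCoeff α β γ (n + 1)) =O[atTop] fun n : ℕ => (n : ℝ) ^ (α + β - γ - 1) := by
  have h := ((tendsto_poch_div α).mul (tendsto_poch_div β)).div (tendsto_poch_div γ)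
    (inv_ne_zero (Real.Gamma_pos_of_pos hγ).ne')
  have h1 := (h.mul ((tendsto_natCast_div_add_atTop (1 : ℝ)))).isBigO_one ℝ
  have h2 := h1.mul (Asymptotics.isBigO_refl (fun n : ℕ => (n : ℝ) ^ (α + β - γ - 1)) atTop)
  refine (Asymptotics.IsBigO.congr' h2 ?_ ?_)
  · filter_upwards [eventually_gt_atTop 0] with n hn
    have hn' : (0 : ℝ) < n := by exact_mod_cast hn
    have e1 : (n : ℝ) ^ (α + β - γ - 1) = (n : ℝ) ^ α * (n : ℝ) ^ β / (n : ℝ) ^ γ / n := by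
      rw [Real.rpow_sub_one hn'.ne', Real.rpow_sub hn', Real.rpow_add hn']
    have p1 := (Real.rpow_pos_of_pos hn' α).ne'
    have p2 := (Real.rpow_pos_of_pos hn' β).ne'
    have p3 := (Real.rpow_pos_of_pos hn' γ).ne'
    have p4 := (poch_pos hγ (n + 1)).ne'
    have p5 : (n.factorial : ℝ) ≠ 0 := by exact_mod_cast n.factorial_ne_zero
    have p6 : (n : ℝ) + 1 ≠ 0 := by positivity
    simp only [e1, hypCoeff, Pi.div_apply, Nat.factorial_succ, Nat.cast_mul, Nat.cast_add, Nat.cast_one]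
    generalize (n : ℝ) ^ α = A at *
    generalize (n : ℝ) ^ β = B at *
    generalize (n : ℝ) ^ γ = C at *
    field_simp
  · exact Eventually.of_forall fun n => one_mul _

lemma summable_abs_hypCoeff {α β γ : ℝ} (hγ : 0 < γ) (h : 0 < γ - α - β) :
    Summable fun n => |hypCoeff α β γ n| := by
  rw [← summable_nat_add_iff 1]
  exact (summable_of_isBigO_nat (Real.summable_nat_rpow.2 (by linarith))
    (hypCoeff_isBigO α β hγ)).abs

/-- This is the boundary term of the telescoping sum behind the contiguous relation. -/
lemma tendsto_mul_hypCoeff {α β γ : ℝ} (hγ : 0 < γ) (h : 0 < γ - α - β) :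
    Tendsto (fun n : ℕ => (n : ℝ) * hypCoeff α β γ n) atTop (𝓝 0) := by
  rw [← tendsto_add_atTop_iff_nat 1]
  have h1 : (fun n : ℕ => ((n + 1 : ℕ) : ℝ)) =O[atTop] fun n : ℕ => (n : ℝ) := by
    refine Asymptotics.IsBigO.of_bound 2 ?_
    filter_upwards [eventually_ge_atTop 1] with n hn
    have hn' : (1 : ℝ) ≤ n := by exact_mod_cast hn
    rw [Real.norm_of_nonneg (by positivity), Real.norm_of_nonneg (by positivity)]
    push_cast; linarith
  refine (h1.mul (hypCoeff_isBigO α β hγ)).trans_tendsto ?_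
  have h2 : Tendsto (fun n : ℕ => (n : ℝ) ^ (-(γ - α - β))) atTop (𝓝 0) :=
    (tendsto_rpow_neg_atTop h).comp tendsto_natCast_atTop_atTop
  refine h2.congr' ?_
  filter_upwards [eventually_gt_atTop 0] with n hn
  have hn' : (0 : ℝ) < n := by exact_mod_cast hn
  rw [← Real.rpow_one_add' hn'.le (by linarith)]
  congr 1; ring

lemma hypCoeff_param_succ (α β : ℝ) {γ : ℝ} (hγ : 0 < γ) (n : ℕ) :
    hypCoeff α β (γ + 1) n * (γ + n) = hypCoeff α β γ n * γ := by
  have e : poch (γ + 1) n * γ = poch γ n * (γ + n) := by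
    rw [← poch_succ, poch_succ_left, mul_comm]
  have h1 := (poch_pos hγ n).ne'
  have h2 := (poch_pos (add_pos hγ one_pos) n).ne'
  have h3 : (n.factorial : ℝ) ≠ 0 := by exact_mod_cast n.factorial_ne_zero
  unfold hypCoeff
  field_simp
  linear_combination -(poch α n * poch β n) * e

/-- The contiguous relation for `₂F₁(α, β; γ; 1)`. -/
lemma tsum_hypCoeff_step {α β γ : ℝ} (hγ : 0 < γ) (h : 0 < γ - α - β) :
    γ * (γ - α - β) * ∑' n, hypCoeff α β γ n =
      (γ - α) * (γ - β) * ∑' n, hypCoeff α β (γ + 1) n := by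
  have s1 := (summable_abs_hypCoeff hγ h).of_abs
  have s2 := (summable_abs_hypCoeff (α := α) (β := β) (γ := γ + 1) (by linarith) (by linarith)).of_abs
  have hd := (s1.mul_left (γ * (γ - α - β))).sub (s2.mul_left ((γ - α) * (γ - β)))
  -- The contiguous relation holds termwise up to a difference of consecutive values of `γ * n *
  -- hypCoeff α β γ n`, so summation telescopes.
  have key : ∀ n : ℕ, γ * (γ - α - β) * hypCoeff α β γ n -
      (γ - α) * (γ - β) * hypCoeff α β (γ + 1) n =
      γ * ((n : ℝ) * hypCoeff α β γ n) - γ * (((n + 1 : ℕ) : ℝ) * hypCoeff α β γ (n + 1)) := by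
    intro n
    have h0 : γ + n ≠ 0 := by positivity
    have e1 := hypCoeff_param_succ α β hγ n
    have e2 := hypCoeff_succ (α := α) (β := β) hγ n
    apply mul_right_cancel₀ h0
    push_cast
    linear_combination -((γ - α) * (γ - β)) * e1 + γ * e2
  have hlim := hd.hasSum.tendsto_sum_nat
  have hlim2 : Tendsto (fun N : ℕ => ∑ n ∈ range N, (γ * (γ - α - β) * hypCoeff α β γ n -
      (γ - α) * (γ - β) * hypCoeff α β (γ + 1) n)) atTop (𝓝 0) := by
    have := ((tendsto_mul_hypCoeff hγ h).const_mul γ).neg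
    rw [mul_zero, neg_zero] at this
    refine this.congr fun N => ?_
    rw [sum_congr rfl fun n _ => key n,
      sum_range_sub' (fun n : ℕ => γ * ((n : ℝ) * hypCoeff α β γ n))]
    simp
  have := tendsto_nhds_unique hlim hlim2
  rw [Summable.tsum_sub (s1.mul_left _) (s2.mul_left _), tsum_mul_left, tsum_mul_left] at this
  linarith

lemma tsum_hypCoeff_shift {α β γ : ℝ} (hγ : 0 < γ) (h : 0 < γ - α - β) (M : ℕ) :
    poch γ M * poch (γ - α - β) M * ∑' n, hypCoeff α β γ n =
      poch (γ - α) M * poch (γ - β) M * ∑' n, hypCoeff α β (γ + M) n := by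
  induction M with
  | zero => simp
  | succ M ih =>
    have hM : (0 : ℝ) ≤ M := M.cast_nonneg
    have := tsum_hypCoeff_step (α := α) (β := β) (γ := γ + M) (by linarith) (by linarith)
    rw [poch_succ, poch_succ, poch_succ, poch_succ,
      show γ + ((M + 1 : ℕ) : ℝ) = γ + M + 1 by push_cast; ring]
    linear_combination (γ + M) * (γ - α - β + M) * ih + poch (γ - α) M * poch (γ - β) M * this

lemma poch_mono {x y : ℝ} (hx : 0 < x) (hxy : x ≤ y) (n : ℕ) : poch x n ≤ poch y n := by
  rw [poch_eq_prod, poch_eq_prod]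
  exact prod_le_prod (fun i _ => by positivity) fun i _ => by linarith

/-- As the lower parameter grows, every term but the zeroth tends to zero, and the series for `γ`
itself is a summable majorant. -/
lemma tendsto_tsum_hypCoeff {α β γ : ℝ} (hγ : 0 < γ) (h : 0 < γ - α - β) :
    Tendsto (fun M : ℕ => ∑' n, hypCoeff α β (γ + M) n) atTop (𝓝 1) := by
  have h1 : (1 : ℝ) = ∑' n : ℕ, if n = 0 then (1 : ℝ) else 0 := by simp
  rw [h1]
  refine tendsto_tsum_of_dominated_convergence (summable_abs_hypCoeff hγ h) (fun n => ?_)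
    (Eventually.of_forall fun M n => ?_)
  · rcases n with _ | n
    · simp [hypCoeff]
    · have hden : Tendsto (fun M : ℕ => poch (γ + M) (n + 1) * ((n + 1).factorial : ℝ)) atTop atTop := by
        refine tendsto_atTop_mono (fun M => ?_) tendsto_natCast_atTop_atTop
        have hM : (0 : ℝ) ≤ M := M.cast_nonneg
        have f1 : (1 : ℝ) ≤ ((n + 1).factorial : ℝ) := by exact_mod_cast (n + 1).factorial_pos
        have f2 : 0 < poch (γ + M + 1) n := poch_pos (by linarith) n
        have f3 : (n.factorial : ℝ) ≤ poch (γ + M + 1) n := by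
          have := poch_mono one_pos (show (1 : ℝ) ≤ γ + M + 1 by linarith) n
          rwa [poch, ascPochhammer_eval_one] at this
        have f4 : (1 : ℝ) ≤ (n.factorial : ℝ) := by exact_mod_cast n.factorial_pos
        rw [poch_succ_left]
        have f5 : (1 : ℝ) ≤ poch (γ + M + 1) n := f4.trans f3
        calc (M : ℝ) ≤ (γ + M) * 1 * 1 := by linarith
          _ ≤ _ := by gcongr
      have := hden.const_div_atTop (poch α (n + 1) * poch β (n + 1))
      simpa [hypCoeff] using this
  · have hM : (0 : ℝ) ≤ M := M.cast_nonneg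
    rw [Real.norm_eq_abs, hypCoeff, hypCoeff, abs_div, abs_div]
    have p1 := poch_pos hγ n
    have p2 := poch_mono hγ (show γ ≤ γ + M by linarith) n
    have p3 : (0 : ℝ) < n.factorial := by exact_mod_cast n.factorial_pos
    rw [abs_of_pos (mul_pos (p1.trans_le p2) p3), abs_of_pos (mul_pos p1 p3)]
    gcongr

/-- **Gauss's summation theorem** for `₂F₁(α, β; γ; 1)`. -/
lemma tsum_hypCoeff_eq {α β γ : ℝ} (hγ : 0 < γ) (h : 0 < γ - α - β)
    (hα : ∀ k : ℕ, γ - α ≠ -(k : ℝ)) (hβ : ∀ k : ℕ, γ - β ≠ -(k : ℝ)) :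
    ∑' n, hypCoeff α β γ n = Real.Gamma γ * Real.Gamma (γ - α - β) /
      (Real.Gamma (γ - α) * Real.Gamma (γ - β)) := by
  have hG1 := (Real.Gamma_pos_of_pos hγ).ne'
  have hG2 := (Real.Gamma_pos_of_pos h).ne'
  have hG3 := Real.Gamma_ne_zero hα
  have hG4 := Real.Gamma_ne_zero hβ
  have hl := ((tendsto_poch_div γ).mul (tendsto_poch_div (γ - α - β))).mul_const
    (∑' n, hypCoeff α β γ n)
  have hr := ((tendsto_poch_div (γ - α)).mul (tendsto_poch_div (γ - β))).mul
    ((tendsto_add_atTop_iff_nat 1).2 (tendsto_tsum_hypCoeff (α := α) (β := β) hγ h))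
  have : (Real.Gamma γ)⁻¹ * (Real.Gamma (γ - α - β))⁻¹ * ∑' n, hypCoeff α β γ n =
      (Real.Gamma (γ - α))⁻¹ * (Real.Gamma (γ - β))⁻¹ * 1 := by
    refine tendsto_nhds_unique_of_eventuallyEq hl hr ?_
    filter_upwards [eventually_gt_atTop 0] with n hn
    have hn' : (0 : ℝ) < n := by exact_mod_cast hn
    have e1 : (n : ℝ) ^ γ * (n : ℝ) ^ (γ - α - β) = (n : ℝ) ^ (γ - α) * (n : ℝ) ^ (γ - β) := by
      rw [← Real.rpow_add hn', ← Real.rpow_add hn']; congr 1; ring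
    -- The shift `n + 1` matches the Pochhammer symbols in Euler's limit; the powers of `n` agree on
    -- both sides by `e1`, and the factorials agree as well.
    have sh := tsum_hypCoeff_shift hγ h (n + 1)
    rw [div_mul_div_comm, div_mul_div_comm, mul_mul_mul_comm, e1, mul_mul_mul_comm ((n : ℝ) ^ (γ - α)),
      div_mul_eq_mul_div, div_mul_eq_mul_div, sh]
  field_simp at this
  field_simp
  linarith

lemma Gamma_add_nat {x : ℝ} (hx : ∀ k : ℕ, x ≠ -(k : ℝ)) (n : ℕ) :
    Real.Gamma (x + n) = poch x n * Real.Gamma x := by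
  induction n with
  | zero => simp
  | succ n ih =>
    have : x + n ≠ 0 := fun h => hx n (by linarith)
    rw [show x + ((n + 1 : ℕ) : ℝ) = x + n + 1 by push_cast; ring, Real.Gamma_add_one this, ih,
      poch_succ]
    ring

end

/-! ### Beta integrals, the Mellin transform and the moments of the weights. -/

section

open Finset Filter Topology MeasureTheory

lemma beta_integrand_ofReal (u v : ℝ) {x : ℝ} (hx : x ∈ Set.Ioo (0 : ℝ) 1) :
    (x : ℂ) ^ ((u : ℂ) - 1) * (1 - (x : ℂ)) ^ ((v : ℂ) - 1) =
      ((x ^ (u - 1) * (1 - x) ^ (v - 1) : ℝ) : ℂ) := by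
  rw [Complex.ofReal_mul, Complex.ofReal_cpow hx.1.le, Complex.ofReal_cpow (sub_pos.2 hx.2).le]
  push_cast
  rfl

lemma integrableOn_beta {u v : ℝ} (hu : 0 < u) (hv : 0 < v) :
    IntegrableOn (fun x : ℝ => x ^ (u - 1) * (1 - x) ^ (v - 1)) (Set.Ioo 0 1) := by
  have h := Complex.betaIntegral_convergent (u := u) (v := v) (by simpa) (by simpa)
  rw [intervalIntegrable_iff_integrableOn_Ioo_of_le zero_le_one] at h
  have h2 := h.congr_fun (fun x hx => beta_integrand_ofReal u v hx) measurableSet_Ioo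
  simpa [IntegrableOn] using h2.re

lemma integral_beta {u v : ℝ} (hu : 0 < u) (hv : 0 < v) :
    ∫ x in Set.Ioo (0 : ℝ) 1, x ^ (u - 1) * (1 - x) ^ (v - 1) =
      Real.Gamma u * Real.Gamma v / Real.Gamma (u + v) := by
  have h := ProbabilityTheory.beta_eq_betaIntegralReal u v hu hv
  rw [ProbabilityTheory.beta] at h
  rw [h, Complex.betaIntegral, intervalIntegral.integral_of_le zero_le_one,
    integral_Ioc_eq_integral_Ioo,
    setIntegral_congr_fun measurableSet_Ioo fun x hx => beta_integrand_ofReal u v hx,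
    integral_complex_ofReal, Complex.ofReal_re]

/-- By Tonelli the series converges absolutely almost everywhere. Hence its sum is an almost
everywhere limit of measurable partial sums, and its norm is dominated by an integrable function. -/
lemma integrable_tsum_of_summable_integral_norm {X : Type*} [MeasurableSpace X] {μ : Measure X}
    {F : ℕ → X → ℝ} (hF : ∀ i, Integrable (F i) μ)
    (hs : Summable fun i => ∫ x, ‖F i x‖ ∂μ) : Integrable (fun x => ∑' i, F i x) μ := by
  have hfin : ∑' i, ∫⁻ x, ‖F i x‖ₑ ∂μ ≠ ⊤ := by
    have : ∀ i, ∫⁻ x, ‖F i x‖ₑ ∂μ = ENNReal.ofReal (∫ x, ‖F i x‖ ∂μ) := fun i =>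
      (ofReal_integral_norm_eq_lintegral_enorm (hF i)).symm
    simp_rw [this]
    exact hs.tsum_ofReal_ne_top
  rw [← lintegral_tsum fun i => (hF i).1.enorm] at hfin
  have hae : ∀ᵐ x ∂μ, Summable fun i => F i x := by
    filter_upwards [ae_lt_top' (AEMeasurable.tsum fun i => (hF i).1.enorm) hfin] with x hx
    exact Summable.of_enorm hx.ne
  refine ⟨aestronglyMeasurable_of_tendsto_ae atTop
    (f := fun n x => ∑ i ∈ range n, F i x)
    (fun n => aestronglyMeasurable_fun_sum _ fun i _ => (hF i).1) ?_, ?_⟩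
  · filter_upwards [hae] with x hx using hx.hasSum.tendsto_sum_nat
  · exact (lintegral_mono fun x => enorm_tsum_le_tsum_enorm).trans_lt (lt_top_iff_ne_top.2 hfin)

lemma ordinaryHypergeometric_eq_tsum_hypCoeff (α β γ x : ℝ) :
    ordinaryHypergeometric α β γ x = ∑' n, hypCoeff α β γ n * x ^ n := by
  rw [ordinaryHypergeometric_eq_tsum]
  refine tsum_congr fun n => ?_
  rw [hypCoeff, smul_eq_mul, poch, poch, poch, div_eq_mul_inv, mul_inv]
  ring

/-- The factor `Γ(δ + n)` of the Beta integral cancels `(δ)_n`, so termwise integration moves the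
lower parameter from `δ` to `s + δ`. -/
lemma hypCoeff_mul_beta (α β : ℝ) {δ s : ℝ} (hδ : 0 < δ) (hs : 0 < s) (n : ℕ) :
    hypCoeff α β δ n * (Real.Gamma s * Real.Gamma (δ + n) / Real.Gamma (s + (δ + n))) =
      Real.Gamma s * Real.Gamma δ / Real.Gamma (s + δ) * hypCoeff α β (s + δ) n := by
  have hsd : 0 < s + δ := add_pos hs hδ
  rw [← add_assoc, Gamma_add_nat (ne_neg_nat_of_pos hδ), Gamma_add_nat (ne_neg_nat_of_pos hsd),
    hypCoeff, hypCoeff]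
  have h1 := (poch_pos hδ n).ne'
  have h2 := (poch_pos hsd n).ne'
  have h3 : (n.factorial : ℝ) ≠ 0 := by exact_mod_cast n.factorial_ne_zero
  have h4 := (Real.Gamma_pos_of_pos hsd).ne'
  field_simp

/-- The Mellin transform of `x ↦ (1 - x)^(δ - 1) ₂F₁(α, β; δ; 1 - x)` on `(0, 1)`. -/
lemma mellin_ordinaryHypergeometric {α β δ s : ℝ} (hδ : 0 < δ) (hs : 0 < s)
    (h : 0 < s + δ - α - β) (hα : ∀ k : ℕ, s + δ - α ≠ -(k : ℝ))
    (hβ : ∀ k : ℕ, s + δ - β ≠ -(k : ℝ)) :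
    IntegrableOn (fun x : ℝ => ordinaryHypergeometric α β δ (1 - x) *
        (x ^ (s - 1) * (1 - x) ^ (δ - 1))) (Set.Ioo 0 1) ∧
      ∫ x in Set.Ioo (0 : ℝ) 1, ordinaryHypergeometric α β δ (1 - x) *
        (x ^ (s - 1) * (1 - x) ^ (δ - 1)) =
      Real.Gamma s * Real.Gamma δ * Real.Gamma (s + δ - α - β) /
        (Real.Gamma (s + δ - α) * Real.Gamma (s + δ - β)) := by
  have hsd : 0 < s + δ := add_pos hs hδ
  let F : ℕ → ℝ → ℝ := fun n x => hypCoeff α β δ n * (x ^ (s - 1) * (1 - x) ^ (δ + n - 1))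
  have hn : ∀ n : ℕ, 0 < δ + n := fun n => by positivity
  have hF : ∀ n, Integrable (F n) (volume.restrict (Set.Ioo 0 1)) := fun n =>
    (integrableOn_beta hs (hn n)).const_mul _
  have hint : ∀ n, ∫ x in Set.Ioo (0 : ℝ) 1, F n x =
      Real.Gamma s * Real.Gamma δ / Real.Gamma (s + δ) * hypCoeff α β (s + δ) n := fun n => by
    rw [integral_const_mul, integral_beta hs (hn n), hypCoeff_mul_beta α β hδ hs]
  -- The Beta kernels are nonnegative, so only the coefficient acquires an absolute value.
  -- Summability is then absolute convergence of the Gauss series with lower parameter `s + δ`.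
  have hnorm : ∀ n, ∫ x in Set.Ioo (0 : ℝ) 1, ‖F n x‖ =
      Real.Gamma s * Real.Gamma δ / Real.Gamma (s + δ) * |hypCoeff α β (s + δ) n| := fun n => by
    have e : ∀ x ∈ Set.Ioo (0 : ℝ) 1, ‖F n x‖ =
        |hypCoeff α β δ n| * (x ^ (s - 1) * (1 - x) ^ (δ + n - 1)) := by
      intro x hx
      have h1 := Real.rpow_nonneg hx.1.le (s - 1)
      have h2 := Real.rpow_nonneg (sub_pos.2 hx.2).le (δ + n - 1)
      rw [norm_mul, Real.norm_eq_abs, Real.norm_of_nonneg (mul_nonneg h1 h2)]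
    have hB : 0 < Real.Gamma s * Real.Gamma (δ + n) / Real.Gamma (s + (δ + n)) :=
      div_pos (mul_pos (Real.Gamma_pos_of_pos hs) (Real.Gamma_pos_of_pos (hn n)))
        (Real.Gamma_pos_of_pos (add_pos hs (hn n)))
    have hC : 0 < Real.Gamma s * Real.Gamma δ / Real.Gamma (s + δ) :=
      div_pos (mul_pos (Real.Gamma_pos_of_pos hs) (Real.Gamma_pos_of_pos hδ))
        (Real.Gamma_pos_of_pos hsd)
    rw [setIntegral_congr_fun measurableSet_Ioo e, integral_const_mul, integral_beta hs (hn n),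
      ← abs_of_pos hB, ← abs_mul, hypCoeff_mul_beta α β hδ hs, abs_mul, abs_of_pos hC]
  have hsum : Summable fun n => ∫ x in Set.Ioo (0 : ℝ) 1, ‖F n x‖ := by
    simp_rw [hnorm]
    exact (summable_abs_hypCoeff hsd h).mul_left _
  have hcongr : ∀ x ∈ Set.Ioo (0 : ℝ) 1, ∑' n, F n x = ordinaryHypergeometric α β δ (1 - x) *
        (x ^ (s - 1) * (1 - x) ^ (δ - 1)) := by
    intro x hx
    rw [ordinaryHypergeometric_eq_tsum_hypCoeff, ← tsum_mul_right]
    refine tsum_congr fun n => ?_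
    have : (1 - x) ^ (δ + n - 1) = (1 - x) ^ n * (1 - x) ^ (δ - 1) := by
      rw [show δ + n - 1 = (δ - 1) + n by ring, Real.rpow_add_natCast (sub_pos.2 hx.2).ne', mul_comm]
    simp only [F, this]
    ring
  refine ⟨(integrable_tsum_of_summable_integral_norm hF hsum).congr
    ((ae_restrict_iff' measurableSet_Ioo).2 (Eventually.of_forall hcongr)), ?_⟩
  rw [← setIntegral_congr_fun measurableSet_Ioo hcongr,
    ← integral_tsum_of_summable_integral_norm hF hsum]
  simp_rw [hint]
  rw [tsum_mul_left, tsum_hypCoeff_eq hsd h hα hβ]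
  have := (Real.Gamma_pos_of_pos hsd).ne'
  have := Real.Gamma_ne_zero hα
  have := Real.Gamma_ne_zero hβ
  field_simp

lemma rpow_add_nat_sub_one {x : ℝ} (hx : 0 < x) (a : ℝ) (k : ℕ) :
    x ^ (a + k - 1) = x ^ (a - 1) * x ^ k := by
  rw [show a + k - 1 = (a - 1) + k by ring, Real.rpow_add_natCast hx.ne']

/-- The moments of the weights, with integrability of the integrands. -/
lemma weight_moment {a b c d : ℝ} (ha : 0 < a) (hb : 0 < b) (hδ : 0 < c + d - a - b)
    (hc : ∀ k : ℕ, c ≠ -(k : ℝ)) (hd : ∀ k : ℕ, d ≠ -(k : ℝ)) {β κ : ℝ} {s r : ℕ}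
    (hβ : β = d - b - s) (k : ℕ) :
    IntegrableOn (fun x : ℝ => ((κ * ordinaryHypergeometric (c - b) β (c + d - a - b) (1 - x)) *
        muDensity a b c d x) * x ^ (k + r)) (Set.Ioo 0 1) ∧
      ∫ x in Set.Ioo (0 : ℝ) 1, ((κ * ordinaryHypergeometric (c - b) β (c + d - a - b) (1 - x)) *
        muDensity a b c d x) * x ^ (k + r) = κ * moment a b c d r (r + s) k := by
  set δ := c + d - a - b with hδ'
  have hkr : (0 : ℝ) ≤ ((k + r : ℕ) : ℝ) := Nat.cast_nonneg _
  have hs : (0 : ℝ) ≤ s := Nat.cast_nonneg _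
  -- For these parameters the Gamma arguments in the Mellin transform are `a`, `b`, `c`, `d` shifted
  -- by natural numbers. The normalisation of `muDensity` therefore reduces them to Pochhammer
  -- symbols, and the convergence condition becomes positivity of `b` plus a shift.
  have e1 : a + ((k + r : ℕ) : ℝ) + δ - (c - b) = d + (k + r : ℕ) := by rw [hδ']; ring
  have e2 : a + ((k + r : ℕ) : ℝ) + δ - β = c + (k + (r + s) : ℕ) := by
    rw [hδ', hβ]; push_cast; ring
  have e3 : a + ((k + r : ℕ) : ℝ) + δ - (c - b) - β = b + (k + (r + s) : ℕ) := by
    rw [hδ', hβ]; push_cast; ring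
  obtain ⟨h1, h2⟩ := mellin_ordinaryHypergeometric (α := c - b) (β := β) hδ
    (show 0 < a + ((k + r : ℕ) : ℝ) by linarith)
    (by rw [e3]; positivity) (by rw [e1]; exact add_nat_ne_neg_nat hd _)
    (by rw [e2]; exact add_nat_ne_neg_nat hc _)
  have hcongr : ∀ x ∈ Set.Ioo (0 : ℝ) 1,
      (κ * (Real.Gamma c * Real.Gamma d / (Real.Gamma a * Real.Gamma b * Real.Gamma δ))) *
        (ordinaryHypergeometric (c - b) β δ (1 - x) *
        (x ^ (a + ((k + r : ℕ) : ℝ) - 1) * (1 - x) ^ (δ - 1))) =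
      ((κ * ordinaryHypergeometric (c - b) β δ (1 - x)) * muDensity a b c d x) * x ^ (k + r) := by
    intro x hx
    rw [rpow_add_nat_sub_one hx.1, muDensity, ← hδ']
    ring
  refine ⟨IntegrableOn.congr_fun (h1.const_mul _) hcongr measurableSet_Ioo, ?_⟩
  rw [← setIntegral_congr_fun measurableSet_Ioo hcongr, integral_const_mul, h2, e3, e1, e2,
    Gamma_add_nat (ne_neg_nat_of_pos ha), Gamma_add_nat (ne_neg_nat_of_pos hb),
    Gamma_add_nat hc, Gamma_add_nat hd, moment]
  have := (Real.Gamma_pos_of_pos ha).ne'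
  have := (Real.Gamma_pos_of_pos hb).ne'
  have := (Real.Gamma_pos_of_pos hδ).ne'
  have := Real.Gamma_ne_zero hc
  have := Real.Gamma_ne_zero hd
  have := poch_ne_zero hc (k + (r + s))
  have := poch_ne_zero hd (k + r)
  field_simp

/-- Reading the index as a natural number lets one moment computation serve both weights. -/
lemma weight_eq (a b c d : ℝ) (j : Fin 2) (x : ℝ) :
    weight a b c d j x = (c / b) ^ (j : ℕ) *
      ordinaryHypergeometric (c - b) (d - b - (j : ℕ)) (c + d - a - b) (1 - x) := by
  fin_cases j <;> simp [weight]

section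

variable {a b c d : ℝ} (ha : 0 < a) (hb : 0 < b) (hδ : 0 < c + d - a - b)
  (hc : ∀ k : ℕ, c ≠ -(k : ℝ)) (hd : ∀ k : ℕ, d ≠ -(k : ℝ))

lemma wInt_def' {E : Type*} [NormedAddCommGroup E] [NormedSpace ℝ E] (j : Fin 2) (f : ℝ → E) :
    wInt a b c d j f = ∫ x in Set.Ioo (0 : ℝ) 1, (weight a b c d j x * muDensity a b c d x) • f x := by
  rw [wInt, intervalIntegral.integral_of_le zero_le_one, integral_Ioc_eq_integral_Ioo]

include ha hb hδ hc hd

lemma integrableOn_weight (j : Fin 2) :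
    IntegrableOn (fun x => weight a b c d j x * muDensity a b c d x) (Set.Ioo 0 1) := by
  simpa [weight_eq] using (weight_moment ha hb hδ hc hd (β := d - b - (j : ℕ))
    (κ := (c / b) ^ (j : ℕ)) (r := 0) rfl 0).1

lemma wInt_pow (j : Fin 2) (k r : ℕ) :
    wInt a b c d j (fun x => x ^ (k + r)) = (c / b) ^ (j : ℕ) * moment a b c d r (r + j) k := by
  rw [wInt_def']
  simpa only [weight_eq, smul_eq_mul] using (weight_moment ha hb hδ hc hd
    (β := d - b - (j : ℕ)) (κ := (c / b) ^ (j : ℕ)) (r := r) rfl k).2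

lemma integrableOn_weight_smul {E : Type*} [NormedAddCommGroup E] [NormedSpace ℝ E] (j : Fin 2)
    {f : ℝ → E} (hf : ContinuousOn f (Set.Icc 0 1)) :
    IntegrableOn (fun x => (weight a b c d j x * muDensity a b c d x) • f x) (Set.Ioo 0 1) := by
  have h := (integrableOn_Icc_iff_integrableOn_Ioo).2 (integrableOn_weight ha hb hδ hc hd j)
  exact (h.smul_continuousOn hf isCompact_Icc).mono_set Set.Ioo_subset_Icc_self

/-- The passage from analysis to algebra: orthogonality and generalized moments depend on the
weights only through `pairing`. -/
lemma wInt_poly_mul_pow (j : Fin 2) (B : ℝ[X]) (r : ℕ) :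
    wInt a b c d j (fun x => B.eval x * x ^ r) =
      (c / b) ^ (j : ℕ) * pairing a b c d r (r + j) B := by
  rw [pairing_eq_sum_range _ _ _ _ _ _ (Nat.lt_succ_self _), mul_sum, wInt_def']
  have : ∀ x, (weight a b c d j x * muDensity a b c d x) • (B.eval x * x ^ r) =
      ∑ k ∈ range (B.natDegree + 1), B.coeff k *
        ((weight a b c d j x * muDensity a b c d x) • x ^ (k + r)) := by
    intro x
    rw [eval_eq_sum_range, sum_mul, smul_sum]
    refine sum_congr rfl fun k _ => ?_
    rw [pow_add]; simp only [smul_eq_mul]; ring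
  simp_rw [this]
  rw [integral_finsetSum _ fun k _ => (integrableOn_weight_smul ha hb hδ hc hd j
    (continuous_pow (k + r)).continuousOn).const_mul _]
  refine sum_congr rfl fun k _ => ?_
  rw [integral_const_mul, ← wInt_def' j fun x : ℝ => x ^ (k + r), wInt_pow ha hb hδ hc hd]
  ring

end

end

/-! ### Associated polynomials, functions of the second kind and their expansion at infinity. -/

section

open Finset Filter Topology MeasureTheory

section

variable {a b c d : ℝ}

lemma wInt_ofReal (j : Fin 2) (f : ℝ → ℝ) :
    wInt a b c d j (fun x => ((f x : ℝ) : ℂ)) = ((wInt a b c d j f : ℝ) : ℂ) := by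
  rw [wInt_def', wInt_def', ← integral_complex_ofReal]
  refine integral_congr_ae (Eventually.of_forall fun x => ?_)
  simp

lemma wInt_const_mul (j : Fin 2) (y : ℂ) (f : ℝ → ℂ) :
    wInt a b c d j (fun x => y * f x) = y * wInt a b c d j f := by
  rw [wInt_def', wInt_def', ← integral_const_mul]
  refine integral_congr_ae (Eventually.of_forall fun x => ?_)
  simp only [Complex.real_smul]; ring

lemma wInt_congr {E : Type*} [NormedAddCommGroup E] [NormedSpace ℝ E] (j : Fin 2) {f g : ℝ → E}
    (h : ∀ x ∈ Set.Ioo (0 : ℝ) 1, f x = g x) : wInt a b c d j f = wInt a b c d j g := by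
  rw [wInt_def', wInt_def']
  exact setIntegral_congr_fun measurableSet_Ioo fun x hx => by simp only [h x hx]

lemma sub_ofReal_ne_zero {z : ℂ} (hz : z ∉ unitSegment) {x : ℝ} (hx : x ∈ Set.Icc (0 : ℝ) 1) :
    z - (x : ℂ) ≠ 0 := fun h => hz ⟨x, hx, (sub_eq_zero.1 h).symm⟩

/-- The associated polynomial `∫₀¹ (B(X) - B(x)) / (X - x) w_j(x) dμ(x)`. -/
noncomputable def assocPoly (a b c d : ℝ) (j : Fin 2) (B : ℝ[X]) : ℝ[X] :=
  ∑ k ∈ range (B.natDegree + 1), ∑ i ∈ range k,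
    C (B.coeff k * wInt a b c d j (fun x => x ^ (k - 1 - i))) * X ^ i

lemma assocPoly_degree_lt (j : Fin 2) (B : ℝ[X]) :
    (assocPoly a b c d j B).degree < (B.natDegree : WithBot ℕ) := by
  refine (degree_sum_le _ _).trans_lt ((Finset.sup_lt_iff (WithBot.bot_lt_coe _)).2 fun k hk => ?_)
  refine (degree_sum_le _ _).trans_lt ((Finset.sup_lt_iff (WithBot.bot_lt_coe _)).2 fun i hi => ?_)
  refine (degree_C_mul_X_pow_le _ _).trans_lt ?_
  have := mem_range.1 hk
  have := mem_range.1 hi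
  exact_mod_cast (by omega : i < B.natDegree)

/-- Dividing `z ^ k - x ^ k` by `z - x` separates powers of `z` from powers of `x`; integrating the
latter gives the coefficients of `assocPoly`. -/
lemma div_sub_eq_sum (B : ℝ[X]) {z : ℂ} {x : ℝ} (h : z - (x : ℂ) ≠ 0) :
    (aeval z B - ((B.eval x : ℝ) : ℂ)) / (z - (x : ℂ)) =
      ∑ k ∈ range (B.natDegree + 1), ∑ i ∈ range k,
        ((B.coeff k : ℂ) * z ^ i) * ((x ^ (k - 1 - i) : ℝ) : ℂ) := by
  rw [div_eq_iff h, aeval_eq_sum_range, eval_eq_sum_range, Complex.ofReal_sum, ← sum_sub_distrib,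
    sum_mul]
  refine sum_congr rfl fun k _ => ?_
  have := geom_sum₂_mul z (x : ℂ) k
  rw [Complex.real_smul]
  push_cast
  rw [← mul_sub, ← this, ← mul_assoc, mul_sum]
  congr 1
  exact sum_congr rfl fun i _ => by ring

variable (ha : 0 < a) (hb : 0 < b) (hδ : 0 < c + d - a - b)
  (hc : ∀ k : ℕ, c ≠ -(k : ℝ)) (hd : ∀ k : ℕ, d ≠ -(k : ℝ))

include ha hb hδ hc hd

lemma wInt_finsetSum {ι E : Type*} [NormedAddCommGroup E] [NormedSpace ℝ E] (j : Fin 2)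
    (s : Finset ι) (f : ι → ℝ → E) (hf : ∀ i ∈ s, ContinuousOn (f i) (Set.Icc 0 1)) :
    wInt a b c d j (fun x => ∑ i ∈ s, f i x) = ∑ i ∈ s, wInt a b c d j (f i) := by
  simp_rw [wInt_def', smul_sum]
  exact integral_finsetSum _ fun i hi => integrableOn_weight_smul ha hb hδ hc hd j (hf i hi)

lemma aeval_assocPoly (j : Fin 2) (B : ℝ[X]) {z : ℂ} (hz : z ∉ unitSegment) :
    aeval z (assocPoly a b c d j B) = associated a b c d B j z := by
  rw [associated, wInt_congr j fun x hx =>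
    div_sub_eq_sum B (sub_ofReal_ne_zero hz (Set.Ioo_subset_Icc_self hx)),
    wInt_finsetSum ha hb hδ hc hd j _ _ fun k _ => by fun_prop, assocPoly, map_sum]
  refine sum_congr rfl fun k _ => ?_
  rw [wInt_finsetSum ha hb hδ hc hd j _ _ fun k _ => by fun_prop, map_sum]
  refine sum_congr rfl fun i _ => ?_
  rw [wInt_const_mul, wInt_ofReal]
  simp only [map_mul, map_pow, aeval_X, aeval_C, Complex.coe_algebraMap]
  ring

lemma aeval_mul_stieltjes_sub (j : Fin 2) (B : ℝ[X]) {z : ℂ} (hz : z ∉ unitSegment) :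
    aeval z B * stieltjes a b c d j z - associated a b c d B j z = secondKind a b c d B j z := by
  have hcont : ∀ g : ℝ → ℂ, ContinuousOn g (Set.Icc 0 1) →
      ContinuousOn (fun x : ℝ => g x / (z - (x : ℂ))) (Set.Icc 0 1) := fun g hg =>
    hg.div (by fun_prop) fun x hx => sub_ofReal_ne_zero hz hx
  have hB : Continuous fun x : ℝ => ((B.eval x : ℝ) : ℂ) :=
    Complex.continuous_ofReal.comp B.continuous
  rw [stieltjes, ← wInt_const_mul, associated, secondKind, wInt_def', wInt_def', wInt_def',
    ← integral_sub]
  · refine integral_congr_ae (Eventually.of_forall fun x => ?_)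
    simp only [Complex.real_smul]
    ring
  · exact integrableOn_weight_smul ha hb hδ hc hd j
      (continuousOn_const.mul (hcont _ continuousOn_const))
  · exact integrableOn_weight_smul ha hb hδ hc hd j
      (hcont _ (continuousOn_const.sub hB.continuousOn))

/-- Powers of `x` are at most `1` on the interval, so the bound is uniform in `k` and a geometric
series dominates the expansion for `|z| > 1`. -/
lemma norm_wInt_mul_pow_le (j : Fin 2) (B : ℝ[X]) (k : ℕ) :
    ∫ x in Set.Ioo (0 : ℝ) 1, ‖(weight a b c d j x * muDensity a b c d x) • (B.eval x * x ^ k)‖ ≤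
      ∫ x in Set.Ioo (0 : ℝ) 1, ‖(weight a b c d j x * muDensity a b c d x) • B.eval x‖ := by
  have hB := B.continuous
  refine setIntegral_mono_on
    (integrableOn_weight_smul ha hb hδ hc hd j (by fun_prop)).norm
    (integrableOn_weight_smul ha hb hδ hc hd j (by fun_prop)).norm measurableSet_Ioo fun x hx => ?_
  rw [← smul_mul_assoc, norm_mul]
  refine mul_le_of_le_one_right (norm_nonneg _) ?_
  rw [norm_pow, Real.norm_of_nonneg hx.1.le]
  exact pow_le_one₀ hx.1.le hx.2.le

lemma hasSum_secondKind (j : Fin 2) (B : ℝ[X]) {z : ℂ} (hz : 1 < ‖z‖) :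
    HasSum (fun k : ℕ => ((wInt a b c d j (fun x => B.eval x * x ^ k) : ℝ) : ℂ) / z ^ (k + 1))
      (secondKind a b c d B j z) := by
  have hz0 : z ≠ 0 := norm_pos_iff.1 (one_pos.trans hz)
  let F : ℕ → ℝ → ℂ := fun k x =>
    (((weight a b c d j x * muDensity a b c d x) • (B.eval x * x ^ k) : ℝ) : ℂ) * (z ^ (k + 1))⁻¹
  have hB := B.continuous
  have hF : ∀ k, Integrable (F k) (volume.restrict (Set.Ioo 0 1)) := fun k =>
    (integrableOn_weight_smul ha hb hδ hc hd j (f := fun x => B.eval x * x ^ k)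
      (by fun_prop)).ofReal.mul_const _
  have hsum : Summable fun k => ∫ x in Set.Ioo (0 : ℝ) 1, ‖F k x‖ := by
    refine Summable.of_nonneg_of_le (fun k => integral_nonneg fun x => norm_nonneg _) (fun k => ?_)
      ((summable_geometric_of_lt_one (inv_nonneg.2 (norm_nonneg z))
        (inv_lt_one_of_one_lt₀ hz)).mul_left
        ((∫ x in Set.Ioo (0 : ℝ) 1, ‖(weight a b c d j x * muDensity a b c d x) • B.eval x‖)
          * ‖z‖⁻¹))
    simp only [F, norm_mul, Complex.norm_real]
    rw [integral_mul_const]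
    have := norm_wInt_mul_pow_le ha hb hδ hc hd j B k
    rw [norm_inv, norm_pow, pow_succ', mul_inv, ← inv_pow, mul_assoc]
    exact mul_le_mul_of_nonneg_right this (by positivity)
  have key := hasSum_integral_of_summable_integral_norm hF hsum
  have e1 : ∀ k, ∫ x in Set.Ioo (0 : ℝ) 1, F k x =
      ((wInt a b c d j (fun x => B.eval x * x ^ k) : ℝ) : ℂ) / z ^ (k + 1) := fun k => by
    rw [integral_mul_const, integral_complex_ofReal, ← wInt_def' j fun x => B.eval x * x ^ k,
      div_eq_mul_inv]
  have e2 : ∫ x in Set.Ioo (0 : ℝ) 1, ∑' k, F k x = secondKind a b c d B j z := by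
    rw [secondKind, wInt_def']
    refine setIntegral_congr_fun measurableSet_Ioo fun x hx => ?_
    have hxz : ‖(x : ℂ) / z‖ < 1 := by
      rw [norm_div, Complex.norm_real, Real.norm_of_nonneg hx.1.le, div_lt_one (one_pos.trans hz)]
      exact hx.2.trans hz
    have hg := (hasSum_geometric_of_norm_lt_one hxz).mul_left
      (((weight a b c d j x * muDensity a b c d x * B.eval x : ℝ) : ℂ) / z)
    have hzx : z - x ≠ 0 := by
      intro h
      rw [← sub_eq_zero.1 h, div_self hz0] at hxz
      simp at hxz
    have hval : (((weight a b c d j x * muDensity a b c d x * B.eval x : ℝ) : ℂ) / z) *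
        (1 - (x : ℂ) / z)⁻¹ = (weight a b c d j x * muDensity a b c d x) •
          (((B.eval x : ℝ) : ℂ) / (z - (x : ℂ))) := by
      have : 1 - (x : ℂ) / z = (z - x) / z := by field_simp
      rw [this, Complex.real_smul]
      push_cast
      field_simp
    rw [hval] at hg
    refine Eq.trans (tsum_congr fun k => ?_) hg.tsum_eq
    simp only [F, smul_eq_mul, div_pow]
    push_cast
    field_simp
    ring
  rw [e2] at key
  simpa only [e1] using key

lemma hasSumLocallyUniformlyOn_secondKind (j : Fin 2) (B : ℝ[X]) (n : ℕ)
    (hn : ∀ k < n, wInt a b c d j (fun x => B.eval x * x ^ k) = 0) :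
    HasSumLocallyUniformlyOn
      (fun (k : ℕ) (z : ℂ) => (eta a b c d B j n k : ℂ) / z ^ (n + k + 1))
      (secondKind a b c d B j) {z : ℂ | 1 < ‖z‖} := by
  have hpt : ∀ z : ℂ, 1 < ‖z‖ → HasSum (fun k : ℕ => (eta a b c d B j n k : ℂ) / z ^ (n + k + 1))
      (secondKind a b c d B j z) := by
    intro z hz
    -- Orthogonality annihilates the first `n` terms, so dropping them does not change the sum.
    have := (hasSum_nat_add_iff' n).2 (hasSum_secondKind ha hb hδ hc hd j B hz)
    rw [sum_eq_zero fun k hk => by rw [hn k (mem_range.1 hk)]; simp, sub_zero] at this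
    refine this.congr_fun ?_
    intro k
    rw [eta, add_comm n k]
  refine hasSumLocallyUniformlyOn_of_of_forall_exists_nhds fun z₀ hz₀ => ?_
  obtain ⟨ρ, hρ1, hρ⟩ := exists_between (show (1 : ℝ) < ‖z₀‖ from hz₀)
  refine ⟨{z | ρ < ‖z‖}, mem_nhdsWithin_of_mem_nhds
    ((isOpen_lt continuous_const continuous_norm).mem_nhds hρ), ?_⟩
  have hρ0 : 0 < ρ := one_pos.trans hρ1
  set K := ∫ x in Set.Ioo (0 : ℝ) 1, ‖(weight a b c d j x * muDensity a b c d x) • B.eval x‖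
  have hu : HasSumUniformlyOn (fun (k : ℕ) (z : ℂ) => (eta a b c d B j n k : ℂ) / z ^ (n + k + 1))
      (fun z => ∑' k : ℕ, (eta a b c d B j n k : ℂ) / z ^ (n + k + 1)) {z | ρ < ‖z‖} := by
    refine HasSumUniformlyOn.of_norm_le_summable (u := fun k => K * ρ⁻¹ ^ k)
      ((summable_geometric_of_lt_one (inv_nonneg.2 hρ0.le) (inv_lt_one_of_one_lt₀ hρ1)).mul_left _)
      fun k z hz => ?_
    have h1 : ‖(eta a b c d B j n k : ℂ)‖ ≤ K := by
      rw [Complex.norm_real, eta, wInt_def']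
      exact (norm_integral_le_integral_norm _).trans (norm_wInt_mul_pow_le ha hb hδ hc hd j B _)
    -- Since `ρ > 1`, the surplus exponent `n + 1` can be discarded, which leaves the majorant `K *
    -- ρ⁻¹ ^ k` on the neighbourhood `ρ < ‖z‖`.
    have h2 : ρ ^ k ≤ ‖z‖ ^ (n + k + 1) :=
      (pow_le_pow_right₀ hρ1.le (by omega)).trans (pow_le_pow_left₀ hρ0.le (le_of_lt hz) _)
    rw [norm_div, norm_pow, inv_pow, ← div_eq_mul_inv]
    exact div_le_div₀ ((norm_nonneg _).trans h1) h1 (pow_pos hρ0 _) h2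
  exact hu.congr_right fun z hz => (hpt z (hρ1.trans hz)).tsum_eq

end

end

/-! ### The poles `theta` and the evaluation of the generalized moments. -/

section

open Finset

lemma theta_castAdd (c e : ℝ) (p q : ℕ) (i : Fin p) :
    theta c e p q (Fin.castAdd q i) = c + (i : ℕ) := by simp [theta]

lemma theta_natAdd (c e : ℝ) (p q : ℕ) (i : Fin q) :
    theta c e p q (Fin.natAdd p i) = e + (i : ℕ) := by simp [theta]

lemma theta_injective {c e : ℝ} (h : ∀ k : ℤ, c - e ≠ (k : ℝ)) (p q : ℕ) :
    Function.Injective (theta c e p q) := by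
  have hne : ∀ (i : Fin p) (j : Fin q), c + ((i : ℕ) : ℝ) ≠ e + ((j : ℕ) : ℝ) := fun i j hij =>
    h ((j : ℕ) - (i : ℕ) : ℤ) (by push_cast; linarith)
  intro x y
  induction x using Fin.addCases with
  | left i =>
    induction y using Fin.addCases with
    | left j =>
      rw [theta_castAdd, theta_castAdd, add_right_inj, Nat.cast_inj]
      intro hij; rw [Fin.ext hij]
    | right j =>
      rw [theta_castAdd, theta_natAdd]
      exact fun hij => absurd hij (hne i j)
  | right i =>
    induction y using Fin.addCases with
    | left j =>
      rw [theta_castAdd, theta_natAdd]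
      exact fun hij => absurd hij.symm (hne j i)
    | right j =>
      rw [theta_natAdd, theta_natAdd, add_right_inj, Nat.cast_inj]
      intro hij; rw [Fin.ext hij]

lemma theta_add_ne {c e : ℝ} {n : ℕ} (hc : ∀ k : ℕ, c + n ≠ -(k : ℝ))
    (he : ∀ k : ℕ, e + n ≠ -(k : ℝ)) (p q : ℕ) (l : Fin (p + q)) (k : ℕ) :
    theta c e p q l + n ≠ -(k : ℝ) := by
  induction l using Fin.addCases with
  | left i => rw [theta_castAdd, add_right_comm]; exact add_nat_ne_neg_nat hc i k
  | right i => rw [theta_natAdd, add_right_comm]; exact add_nat_ne_neg_nat he i k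

lemma prod_theta_add (c e t : ℝ) (p q : ℕ) :
    ∏ l, (theta c e p q l + t) = poch (c + t) p * poch (e + t) q := by
  rw [Fin.prod_univ_add, poch_eq_prod, poch_eq_prod,
    ← Fin.prod_univ_eq_prod_range (fun i => c + t + (i : ℝ)),
    ← Fin.prod_univ_eq_prod_range (fun i => e + t + (i : ℝ))]
  congr 1 <;> refine prod_congr rfl fun i _ => ?_
  · rw [theta_castAdd]; ring
  · rw [theta_natAdd]; ring

/-- The poles are taken at `x l = theta l + n`: the differences between poles do not see the shift,
and `(θ + n)_(N+1)` splits as `(θ + n) (θ + n + 1)_N`. The free constant `Kd` lets the same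
computation cover both `e = d` and `e = d - 1`. -/
lemma pairing_hypPoly_theta {a b c d e : ℝ} (ha : 0 < a) (hb : 0 < b)
    (hc : ∀ k : ℕ, c ≠ -(k : ℝ)) (hd : ∀ k : ℕ, d ≠ -(k : ℝ)) {N n m s S R : ℕ} {Kd : ℝ}
    (he : ∀ k : ℕ, e + n ≠ -(k : ℝ)) (hce : ∀ k : ℤ, c - e ≠ (k : ℝ)) (hs : s = n + S)
    (hKd : ∀ k, poch d (k + (n + m)) = Kd * (poch (e + n) k * poch (e + n + k) R))
    (hrs : n + m + s < N + (S + R)) :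
    pairing a b c d (n + m) s (hypPoly a b (c + n) (e + n) N) =
      (-1) ^ (N + (n + m) + s) * (N.factorial * poch a N * poch b N /
        (poch c (n + N) * (Kd * poch (e + n) N))) *
      ∑ l, poch (theta c e S R l - a - m + 1) (n + m) * poch (theta c e S R l - b - S + 1) s /
        ((∏ i ∈ univ.erase l, (theta c e S R i - theta c e S R l)) * (theta c e S R l + n) *
          poch (theta c e S R l + n + 1) N) := by
  rw [pairing_hypPoly ha hb hc hd (S := S) (R := R) (Kc := poch c n) (Kd := Kd) ?_ hKd hrs
    (fun l => theta c e S R l + n) ?_ (fun l k => theta_add_ne (add_nat_ne_neg_nat hc n) he S R l k)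
    ?_, ← poch_add]
  · congr 1
    refine sum_congr rfl fun l _ => ?_
    rw [poch_succ_left, hs]
    congr 1
    · congr 2 <;> push_cast <;> ring
    · rw [mul_assoc]
      congr 1
      exact prod_congr rfl fun i _ => by ring
  · intro k
    rw [hs, show k + (n + S) = n + k + S by ring, poch_add, poch_add c n k]
    push_cast
    rw [show c + (↑n + ↑k) = c + n + k by ring, mul_assoc]
  · intro x y h
    exact theta_injective hce S R (add_right_cancel h)
  · intro k
    simp_rw [add_assoc]
    exact prod_theta_add c e (n + k) S R

/-- The constant is `(d)_(n-1)`. For `n = 0` it equals `1 / (d - 1)`, which is where the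
integer-index symbol and the exception `d = 1` come from. -/
lemma poch_shift_pred {d : ℝ} {n : ℕ} (hn : n = 0 → d ≠ 1) :
    ∃ K : ℝ, K * poch (d - 1 + n) (2 * n) = pochInt d (3 * (n : ℤ) - 1) ∧
      ∀ m k : ℕ, poch d (k + (n + m)) =
        K * (poch (d - 1 + n) k * poch (d - 1 + n + k) (m + 1)) := by
  rcases n with _ | n
  · have h1 : d - 1 ≠ 0 := sub_ne_zero.2 (hn rfl)
    refine ⟨1 / (d - 1), ?_, fun m k => ?_⟩
    · have : (3 * ((0 : ℕ) : ℤ) - 1) = Int.negSucc 0 := rfl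
      rw [this]
      simp [pochInt, poch_succ]
    · rw [Nat.cast_zero, add_zero, ← poch_add, zero_add, show k + (m + 1) = k + m + 1 from rfl,
        poch_succ_left, sub_add_cancel]
      field_simp
  · have e : d - 1 + ((n + 1 : ℕ) : ℝ) = d + n := by push_cast; ring
    refine ⟨poch d n, ?_, fun m k => ?_⟩
    · have : (3 * ((n + 1 : ℕ) : ℤ) - 1) = Int.ofNat (n + 2 * (n + 1)) := by
        simp only [Int.ofNat_eq_natCast]; push_cast; ring
      rw [this, e, ← poch_add]
      rfl
    · rw [e, ← mul_assoc, ← poch_add, show k + (n + 1 + m) = n + k + (m + 1) by ring, poch_add]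
      push_cast; rw [add_assoc d]

section

variable {a b c d : ℝ} (ha : 0 < a) (hb : 0 < b) (hδ : 0 < c + d - a - b)
  (hc : ∀ k : ℕ, c ≠ -(k : ℝ)) (hd : ∀ k : ℕ, d ≠ -(k : ℝ))

include ha hb hδ hc hd

lemma eta_eq_pairing (B : ℝ[X]) (j : Fin 2) (n m : ℕ) :
    eta a b c d B j n m = (c / b) ^ (j : ℕ) * pairing a b c d (n + m) (n + m + j) B :=
  wInt_poly_mul_pow ha hb hδ hc hd j B (n + m)

/-- Even `i` encode the conditions for the first weight and odd `i` those for the second; the factor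
`c / b` is nonzero and drops out. -/
lemma isTypeII_iff (N : ℕ) (B : ℝ[X]) : IsTypeII a b c d N B ↔ B.Monic ∧ B.natDegree = N ∧
    ∀ i < N, pairing a b c d (i / 2) ((i + 1) / 2) B = 0 := by
  have hcb : c / b ≠ 0 := div_ne_zero (by simpa using hc 0) hb.ne'
  have h0 : ∀ k, wInt a b c d 0 (fun x => B.eval x * x ^ k) = 0 ↔
      pairing a b c d (2 * k / 2) ((2 * k + 1) / 2) B = 0 := fun k => by
    rw [wInt_poly_mul_pow ha hb hδ hc hd, show 2 * k / 2 = k by omega,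
      show (2 * k + 1) / 2 = k by omega]
    simp
  have h1 : ∀ k, wInt a b c d 1 (fun x => B.eval x * x ^ k) = 0 ↔
      pairing a b c d ((2 * k + 1) / 2) ((2 * k + 1 + 1) / 2) B = 0 := fun k => by
    rw [wInt_poly_mul_pow ha hb hδ hc hd, show (2 * k + 1) / 2 = k by omega,
      show (2 * k + 1 + 1) / 2 = k + 1 by omega]
    simp [hcb]
  unfold IsTypeII
  simp only [h0, h1]
  refine and_congr_right fun _ => and_congr_right fun _ => ⟨fun h i hi => ?_, fun h => ⟨?_, ?_⟩⟩
  · obtain ⟨k, rfl | rfl⟩ := i.even_or_odd'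
    · exact h.1 k (by omega)
    · exact h.2 k (by omega)
  · exact fun k hk => h _ (by omega)
  · exact fun k hk => h _ (by omega)

lemma isTypeII_typeII (N : ℕ) : IsTypeII a b c d N (typeII a b c d N) :=
  (isTypeII_iff ha hb hδ hc hd N _).2 ⟨(typeII_monic_natDegree ha hb hc hd N).1,
    (typeII_monic_natDegree ha hb hc hd N).2, fun _ hi => pairing_typeII_eq_zero ha hb hc hd hi⟩

lemma IsTypeII.eq_typeII
    (hda : ∀ k : ℕ, d - a ≠ -(k : ℝ)) (hdb : ∀ k : ℕ, d - b ≠ -(k : ℝ))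
    (hca : ∀ k : ℕ, c + 1 - a ≠ -(k : ℝ)) (hcb : ∀ k : ℕ, c - b ≠ -(k : ℝ)) {N : ℕ} {B : ℝ[X]}
    (hB : IsTypeII a b c d N B) : B = typeII a b c d N := by
  obtain ⟨hm, hdeg, h⟩ := (isTypeII_iff ha hb hδ hc hd N B).1 hB
  obtain ⟨hm', hdeg'⟩ := typeII_monic_natDegree ha hb hc hd N
  rw [← sub_eq_zero]
  refine eq_zero_of_pairing_eq_zero (N := N) ha hb hc hd hda hdb hca hcb ?_ fun i hi => ?_
  · have := degree_sub_lt_left (p := B) (q := typeII a b c d N) (by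
      rw [degree_eq_natDegree hm.ne_zero, degree_eq_natDegree hm'.ne_zero, hdeg, hdeg'])
      hm.ne_zero (hm.trans hm'.symm)
    rwa [degree_eq_natDegree hm.ne_zero, hdeg] at this
  · rw [pairing_sub, h i hi, pairing_typeII_eq_zero ha hb hc hd hi, sub_zero]

/-- In even degree the second upper parameter is `d - 1 + n`, so the poles in the `d`-family start
at `d - 1` and number `m + 1`. The numerator degree `2n + 2m + j` is then the largest that the
difference formula allows. -/
lemma eta_typeII_even (hcd : ∀ k : ℤ, c - d ≠ (k : ℝ)) (j : Fin 2) {n m S : ℕ}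
    (hn : n = 0 → d ≠ 1) (hS : S = m + j) :
    eta a b c d (typeII a b c d (2 * n)) j n m = (c / b) ^ (j : ℕ) * ((-1) ^ (j : ℕ) *
      (((2 * n).factorial : ℝ) * poch a (2 * n) * poch b (2 * n) /
        (poch c (3 * n) * pochInt d (3 * (n : ℤ) - 1))) *
      ∑ l, poch (theta c (d - 1) S (m + 1) l - a - m + 1) (n + m) *
        poch (theta c (d - 1) S (m + 1) l - b - S + 1) (n + S) /
        ((∏ i ∈ univ.erase l, (theta c (d - 1) S (m + 1) i - theta c (d - 1) S (m + 1) l)) *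
          (theta c (d - 1) S (m + 1) l + n) *
          poch (theta c (d - 1) S (m + 1) l + n + 1) (2 * n))) := by
  obtain ⟨K, hK, hKd⟩ := poch_shift_pred hn
  have he : ∀ k : ℕ, d - 1 + n ≠ -(k : ℝ) := by
    intro k h
    rcases n with _ | n
    · rcases k with _ | k
      · exact hn rfl (by push_cast at h; linarith)
      · exact hd k (by push_cast at h; linarith)
    · exact hd (k + n) (by push_cast at h ⊢; linarith)
  have hce : ∀ k : ℤ, c - (d - 1) ≠ (k : ℝ) := fun k h => hcd (k - 1) (by push_cast; linarith)
  have hp : typeII a b c d (2 * n) = hypPoly a b (c + n) (d - 1 + n) (2 * n) := by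
    rw [typeII, show 2 * n / 2 = n by omega, show (2 * n + 1) / 2 = n by omega]
    congr 1; ring
  rw [eta_eq_pairing ha hb hδ hc hd, hp, pairing_hypPoly_theta ha hb hc hd (S := S) (R := m + 1) he
    hce (by rw [hS]; ring) (hKd m) (by rw [hS]; omega), hK, show n + 2 * n = 3 * n by ring,
    show 2 * n + (n + m) + (n + m + (j : ℕ)) = 2 * (2 * n + m) + j by ring, pow_add, pow_mul,
    neg_one_sq, one_pow, one_mul, hS, add_assoc n m]

/-- In odd degree the second upper parameter is `d + n`, so the `d`-family starts at `d` and has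
only `m` poles; the odd degree also flips the sign. -/
lemma eta_typeII_odd (hcd : ∀ k : ℤ, c - d ≠ (k : ℝ)) (j : Fin 2) {n m S : ℕ} (hS : S = m + j) :
    eta a b c d (typeII a b c d (2 * n + 1)) j n m = (c / b) ^ (j : ℕ) * (-(-1) ^ (j : ℕ) *
      (((2 * n + 1).factorial : ℝ) * poch a (2 * n + 1) * poch b (2 * n + 1) /
        (poch c (3 * n + 1) * poch d (3 * n + 1))) *
      ∑ l, poch (theta c d S m l - a - m + 1) (n + m) *
        poch (theta c d S m l - b - S + 1) (n + S) /
        ((∏ i ∈ univ.erase l, (theta c d S m i - theta c d S m l)) *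
          (theta c d S m l + n) * poch (theta c d S m l + n + 1) (2 * n + 1))) := by
  have hp : typeII a b c d (2 * n + 1) = hypPoly a b (c + n) (d + n) (2 * n + 1) := by
    rw [typeII, show (2 * n + 1) / 2 = n by omega, show (2 * n + 1 + 1) / 2 = n + 1 by omega]
    congr 1; push_cast; ring
  have hKd : ∀ k : ℕ, poch d (k + (n + m)) = poch d n * (poch (d + n) k * poch (d + n + k) m) := by
    intro k
    rw [← mul_assoc, ← poch_add, show k + (n + m) = n + k + m by ring, poch_add]
    push_cast; rw [add_assoc d]
  rw [eta_eq_pairing ha hb hδ hc hd, hp, pairing_hypPoly_theta ha hb hc hd (S := S) (R := m)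
    (add_nat_ne_neg_nat hd n) hcd (by rw [hS]; ring) hKd (by rw [hS]; omega), ← poch_add,
    show n + (2 * n + 1) = 3 * n + 1 by ring,
    show 2 * n + 1 + (n + m) + (n + m + (j : ℕ)) = 2 * (2 * n + m) + 1 + j by ring, pow_add,
    pow_add, pow_mul, neg_one_sq, one_pow, one_mul, pow_one, neg_one_mul, hS, add_assoc n m]

end

end

end HypMOP

/-! ### Assembly of the statement. -/

theorem mainTheorem12 (a b c d : ℝ)
    (ha : 0 < a) (hb : 0 < b) (hδ : 0 < c + d - a - b)
    (hc : ∀ k : ℕ, c ≠ -(k : ℝ)) (hd : ∀ k : ℕ, d ≠ -(k : ℝ))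
    (hda : ∀ k : ℕ, d - a ≠ -(k : ℝ)) (hdb : ∀ k : ℕ, d - b ≠ -(k : ℝ))
    (hca : ∀ k : ℕ, c + 1 - a ≠ -(k : ℝ)) (hcb : ∀ k : ℕ, c - b ≠ -(k : ℝ))
    (hcd : ∀ k : ℤ, c - d ≠ (k : ℝ)) :
    -- all the integrals that occur converge
    (∀ j : Fin 2, IntervalIntegrable
      (fun x => HypMOP.weight a b c d j x * HypMOP.muDensity a b c d x)
      MeasureTheory.volume 0 1) ∧
    -- the type II multiple orthogonal polynomials exist and are unique
    (∀ N : ℕ, ∃! B : Polynomial ℝ, HypMOP.IsTypeII a b c d N B) ∧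
    ∀ B : ℕ → Polynomial ℝ, (∀ N, HypMOP.IsTypeII a b c d N (B N)) →
      -- the remainders of the type II Hermite-Padé approximation
      (∀ (N : ℕ) (j : Fin 2),
        (∃ P : Polynomial ℝ, P.degree < N ∧ ∀ z : ℂ, z ∉ HypMOP.unitSegment →
          Polynomial.aeval z P = HypMOP.associated a b c d (B N) j z ∧
          Polynomial.aeval z (B N) * HypMOP.stieltjes a b c d j z - Polynomial.aeval z P
            = HypMOP.secondKind a b c d (B N) j z) ∧
        HasSumLocallyUniformlyOn
          (fun (k : ℕ) (z : ℂ) =>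
            (HypMOP.eta a b c d (B N) j (N / 2) k : ℂ) / z ^ (N / 2 + k + 1))
          (HypMOP.secondKind a b c d (B N) j) {z : ℂ | 1 < ‖z‖}) ∧
      (∀ n : ℕ, HypMOP.eta a b c d (B (2 * n + 1)) 0 n 0 = 0) ∧
      -- (1)
      (∀ n m : ℕ, 1 ≤ m → (n = 0 → d ≠ 1) →
        HypMOP.eta a b c d (B (2 * n)) 0 n m =
          (Nat.factorial (2 * n) : ℝ) * HypMOP.poch a (2 * n) * HypMOP.poch b (2 * n)
            / (HypMOP.poch c (3 * n) * HypMOP.pochInt d (3 * (n : ℤ) - 1))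
          * ∑ l, HypMOP.poch (HypMOP.theta c (d - 1) m (m + 1) l - a - m + 1) (n + m)
              * HypMOP.poch (HypMOP.theta c (d - 1) m (m + 1) l - b - m + 1) (n + m)
              / ((∏ i ∈ Finset.univ.erase l,
                    (HypMOP.theta c (d - 1) m (m + 1) i - HypMOP.theta c (d - 1) m (m + 1) l))
                * (HypMOP.theta c (d - 1) m (m + 1) l + n)
                * HypMOP.poch (HypMOP.theta c (d - 1) m (m + 1) l + n + 1) (2 * n))) ∧
      -- (2)
      (∀ n m : ℕ, 1 ≤ m →
        HypMOP.eta a b c d (B (2 * n + 1)) 0 n m =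
          -((Nat.factorial (2 * n + 1) : ℝ) * HypMOP.poch a (2 * n + 1)
              * HypMOP.poch b (2 * n + 1)
            / (HypMOP.poch c (3 * n + 1) * HypMOP.poch d (3 * n + 1)))
          * ∑ l, HypMOP.poch (HypMOP.theta c d m m l - a - m + 1) (n + m)
              * HypMOP.poch (HypMOP.theta c d m m l - b - m + 1) (n + m)
              / ((∏ i ∈ Finset.univ.erase l,
                    (HypMOP.theta c d m m i - HypMOP.theta c d m m l))
                * (HypMOP.theta c d m m l + n)
                * HypMOP.poch (HypMOP.theta c d m m l + n + 1) (2 * n + 1))) ∧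
      -- (3)
      (∀ n m : ℕ, (n = 0 → d ≠ 1) →
        HypMOP.eta a b c d (B (2 * n)) 1 n m =
          -(c / b) * ((Nat.factorial (2 * n) : ℝ) * HypMOP.poch a (2 * n) * HypMOP.poch b (2 * n)
            / (HypMOP.poch c (3 * n) * HypMOP.pochInt d (3 * (n : ℤ) - 1)))
          * ∑ l, HypMOP.poch (HypMOP.theta c (d - 1) (m + 1) (m + 1) l - a - m + 1) (n + m)
              * HypMOP.poch (HypMOP.theta c (d - 1) (m + 1) (m + 1) l - b - m) (n + m + 1)
              / ((∏ i ∈ Finset.univ.erase l,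
                    (HypMOP.theta c (d - 1) (m + 1) (m + 1) i
                      - HypMOP.theta c (d - 1) (m + 1) (m + 1) l))
                * (HypMOP.theta c (d - 1) (m + 1) (m + 1) l + n)
                * HypMOP.poch (HypMOP.theta c (d - 1) (m + 1) (m + 1) l + n + 1) (2 * n))) ∧
      -- (4)
      (∀ n m : ℕ, 1 ≤ m →
        HypMOP.eta a b c d (B (2 * n + 1)) 1 n m =
          c / b * ((Nat.factorial (2 * n + 1) : ℝ) * HypMOP.poch a (2 * n + 1)
              * HypMOP.poch b (2 * n + 1)
            / (HypMOP.poch c (3 * n + 1) * HypMOP.poch d (3 * n + 1)))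
          * ∑ l, HypMOP.poch (HypMOP.theta c d (m + 1) m l - a - m + 1) (n + m)
              * HypMOP.poch (HypMOP.theta c d (m + 1) m l - b - m) (n + m + 1)
              / ((∏ i ∈ Finset.univ.erase l,
                    (HypMOP.theta c d (m + 1) m i - HypMOP.theta c d (m + 1) m l))
                * (HypMOP.theta c d (m + 1) m l + n)
                * HypMOP.poch (HypMOP.theta c d (m + 1) m l + n + 1) (2 * n + 1))) := by
  have hint := HypMOP.integrableOn_weight ha hb hδ hc hd
  refine ⟨fun j => (intervalIntegrable_iff_integrableOn_Ioo_of_le zero_le_one).2 (hint j),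
    fun N => ⟨HypMOP.typeII a b c d N, HypMOP.isTypeII_typeII ha hb hδ hc hd N,
      fun B hB => hB.eq_typeII ha hb hδ hc hd hda hdb hca hcb⟩, fun B hB => ?_⟩
  have hBeq : ∀ N, B N = HypMOP.typeII a b c d N := fun N =>
    (hB N).eq_typeII ha hb hδ hc hd hda hdb hca hcb
  refine ⟨fun N j => ⟨⟨HypMOP.assocPoly a b c d j (B N), ?_, fun z hz => ?_⟩, ?_⟩, fun n => ?_,
    fun n m _ hn => ?_, fun n m _ => ?_, fun n m hn => ?_, fun n m _ => ?_⟩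
  · have := HypMOP.assocPoly_degree_lt (a := a) (b := b) (c := c) (d := d) j (B N)
    rwa [(hB N).2.1] at this
  · have h := HypMOP.aeval_assocPoly ha hb hδ hc hd j (B N) hz
    refine ⟨h, ?_⟩
    rw [h]
    exact HypMOP.aeval_mul_stieltjes_sub ha hb hδ hc hd j (B N) hz
  · refine HypMOP.hasSumLocallyUniformlyOn_secondKind ha hb hδ hc hd j (B N) (N / 2) ?_
    match j with
    -- The first weight has `(N + 1) / 2` conditions, one more than needed here when `N` is odd;
    -- that extra condition is the vanishing of the zeroth odd moment.
    | 0 => exact fun k hk => (hB N).2.2.1 k (by omega)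
    | 1 => exact (hB N).2.2.2
  · exact (hB (2 * n + 1)).2.2.1 n (by omega)
  · rw [hBeq, HypMOP.eta_typeII_even ha hb hδ hc hd hcd 0 hn (S := m) rfl]
    simp only [Fin.val_zero, pow_zero, one_mul]
  · rw [hBeq, HypMOP.eta_typeII_odd ha hb hδ hc hd hcd 0 (S := m) rfl]
    simp only [Fin.val_zero, pow_zero, one_mul, neg_mul]
  -- For the second weight the indices at `b` and `c` are one higher, so the `c`-family gains a pole
  -- and `- b - (m + 1) + 1` becomes `- b - m`.
  · rw [hBeq, HypMOP.eta_typeII_even ha hb hδ hc hd hcd 1 hn (S := m + 1) rfl]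
    simp only [Fin.val_one, pow_one, ← mul_assoc, neg_mul, one_mul, mul_neg, Nat.cast_add,
      Nat.cast_one, sub_add_eq_sub_sub, sub_add_cancel]
    rfl
  · rw [hBeq, HypMOP.eta_typeII_odd ha hb hδ hc hd hcd 1 (S := m + 1) rfl]
    simp only [Fin.val_one, pow_one, ← mul_assoc, neg_neg, one_mul, Nat.cast_add,
      Nat.cast_one, sub_add_eq_sub_sub, sub_add_cancel]
    rfl
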